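/- Let $k$ be a field, $n\ge 1$ an integer, and $\mathcal C$ a $k$-linear, Hom-finite $(n+2)$-angulated category (in the sense of Geiss–Keller–Oppermann) with split idempotents and $n$-suspension functor $\Sigma^n$ (an additive autoequivalence of $\mathcal C$). For $M\in\mathcal C$ let $\operatorname{add}M$ be the class of direct summands of finite direct sums of copies of $M$. Let $T\in\mathcal C$ be an Oppermann–Thomas cluster tilting object: $\mathcal C(T,\Sigma^nT)=0$, and every $X\in\mathcal C$ lies in an $(n+2)$-angle $T_0\to T_1\to\cdots\to T_n\to X\to\Sigma^nT_0$ with all $T_i\in\operatorname{add}T$. Put $\Lambda=\operatorname{End}_{\mathcal C}(T)$, let $\operatorname{mod}\Lambda$ be the category of finite-dimensional right $\Lambda$-modules and $\mathcal D$ the essential image of $\mathcal C(T,-)\colon\mathcal C\to\operatorname{mod}\Lambda$. Let $\tau_n=\tau\,\Omega^{n-1}$ be the $n$-Auslander–Reiten translation: if $\cdots\to P_1\to P_0\to M\to0$ is the minimal projective resolution of $M$, then $\tau_nM$ is the kernel of $D\operatorname{Hom}_\Lambda(P_n,\Lambda)\to D\operatorname{Hom}_\Lambda(P_{n-1},\Lambda)$,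 where $D=\operatorname{Hom}_k(-,k)$. For $X,Y\in\mathcal C$ let $[\Sigma^nT](X,Y)$ be the set of morphisms $X\to Y$ that factor through an object of $\operatorname{add}\Sigma^nT$. An object $X\in\mathcal C$ is called - *$\Sigma^nT$-$n$-rigid* if $[\Sigma^nT](X,\Sigma^nX)=0$; - *maximal $\Sigma^nT$-$n$-rigid* if it is $\Sigma^nT$-$n$-rigid and, for every $M\in\mathcal C$, $[\Sigma^nT](X\oplus M,\Sigma^n(X\oplus M))=0$ implies $M\in\operatorname{add}X$; - *$\Sigma^nT$-$n$-self-perpendicular* if $\operatorname{add}X=\{M\in\mathcal C\mid[\Sigma^nT](X,\Sigma^nM)=0=[\Sigma^nT](M,\Sigma^nX)\}$. Let $M\in\mathcal D$ and let $P$ be a finitely generated projective right $\Lambda$-module. - $M$ is *$\tau_n$-rigid* if $\operatorname{Hom}_\Lambda(M,\tau_nM)=0$; $(M,P)$ is a *$\tau_n$-rigid pair* in $\mathcal D$ if moreover $\operatorname{Hom}_\Lambda(P,M)=0$. - $(M,P)$ is a *support $\tau_n$-tilting pair* in $\mathcal D$ if it is a $\tau_n$-rigid pair such that (i) for every $N\in\mathcal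 D$, if $(M\oplus N,P)$ is a $\tau_n$-rigid pair, then $N\in\operatorname{add}M$; and (ii) for every finitely generated projective $Q$, $Q\in\operatorname{add}P$ if and only if $\operatorname{Hom}_\Lambda(Q,M)=0$. - $(M,P)$ is a *maximal $\tau_n$-rigid pair* in $\mathcal D$ if (i) for every $N\in\mathcal D$, $N\in\operatorname{add}M$ if and only if $\operatorname{Hom}_\Lambda(M,\tau_nN)=0$, $\operatorname{Hom}_\Lambda(N,\tau_nM)=0$ and $\operatorname{Hom}_\Lambda(P,N)=0$; and (ii) as above holds. Then: (a) If $M\in\mathcal C$ satisfies $\operatorname{add}M\cap\operatorname{add}\Sigma^nT=\{0\}$, then $M$ is $\Sigma^nT$-$n$-rigid if and only if $\mathcal C(T,M)$ is $\tau_n$-rigid. (b) Every $M\in\mathcal C$ has a decomposition $M\cong M_0\oplus\Sigma^nT_M$ with $T_M\in\operatorname{add}T$ and $M_0$ without nonzero direct summands in $\operatorname{add}\Sigma^nT$. The assignment $M\mapsto(\mathcal C(T,M_0),\mathcal C(T,T_M))$ is well defined on isomorphism classes, and it gives a bijection from the isomorphism classes of $\Sigma^nT$-$n$-rigid objects of $\mathcal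 C$ to the isomorphism classes of $\tau_n$-rigid pairs in $\mathcal D$. (c) The same assignment gives a bijection from the isomorphism classes of maximal $\Sigma^nT$-$n$-rigid objects of $\mathcal C$ to the isomorphism classes of support $\tau_n$-tilting pairs in $\mathcal D$. (d) The same assignment gives a bijection from the isomorphism classes of $\Sigma^nT$-$n$-self-perpendicular objects of $\mathcal C$ to the isomorphism classes of maximal $\tau_n$-rigid pairs in $\mathcal D$. -/

import Mathlib

open CategoryTheory CategoryTheory.Limits ZeroObject

universe w v u

noncomputable section

/-! ### `(n+2)`-angulated categories -/

namespace Angulated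

variable {C : Type u} [Category.{v} C] [Preadditive C]

/-- An `(n+2)`-`Σ`-sequence `X₀ ⟶ X₁ ⟶ ⋯ ⟶ Xₙ₊₁ ⟶ Σ X₀`. -/
structure Seq (S : C ⥤ C) (n : ℕ) where
  /-- the objects `X₀, …, Xₙ₊₁` -/
  obj : Fin (n + 2) → C
  /-- the morphisms `Xᵢ ⟶ Xᵢ₊₁` for `i = 0, …, n` -/
  map : ∀ i : Fin (n + 1), obj i.castSucc ⟶ obj i.succ
  /-- the connecting morphism `Xₙ₊₁ ⟶ Σ X₀` -/
  last : obj (Fin.last (n + 1)) ⟶ S.obj (obj 0)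

namespace Seq

variable {S : C ⥤ C} {n : ℕ}

/-- The first morphism `X₀ ⟶ X₁`. -/
def first (X : Seq S n) : X.obj 0 ⟶ X.obj (Fin.succ 0) := X.map 0

/-- Morphisms of `(n+2)`-`Σ`-sequences; the last square is closed by `Σ φ₀`. -/
structure Hom (X Y : Seq S n) where
  app : ∀ i, X.obj i ⟶ Y.obj i
  comm : ∀ i : Fin (n + 1), X.map i ≫ app i.succ = app i.castSucc ≫ Y.map i
  comm_last : X.last ≫ S.map (app 0) = app (Fin.last (n + 1)) ≫ Y.last

/-- The objects `A, A, 0, …, 0` of the trivial sequence. -/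
def trivialObj [HasZeroObject C] (n : ℕ) (A : C) : Fin (n + 2) → C :=
  Fin.cases A (Fin.cases A (fun _ => (0 : C)))

/-- The trivial sequence `A = A ⟶ 0 ⟶ ⋯ ⟶ 0 ⟶ Σ A`. -/
def trivial [HasZeroObject C] (S : C ⥤ C) (n : ℕ) (A : C) : Seq S n where
  obj := trivialObj n A
  map := Fin.cases (motive := fun i => trivialObj n A i.castSucc ⟶ trivialObj n A i.succ)
    (𝟙 A) (fun _ => 0)
  last := 0

/-- The direct sum of two sequences. -/
def sum [HasBinaryBiproducts C] (X Y : Seq S n) : Seq S n where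
  obj i := X.obj i ⊞ Y.obj i
  map i := biprod.map (X.map i) (Y.map i)
  last := biprod.desc (X.last ≫ S.map biprod.inl) (Y.last ≫ S.map biprod.inr)

/-- The objects `X₁, …, Xₙ₊₁, Σ X₀` of the left rotation. -/
def rotObj (X : Seq S n) : Fin (n + 2) → C :=
  Fin.snoc (α := fun _ => C) (fun j : Fin (n + 1) => X.obj j.succ) (S.obj (X.obj 0))

/-- The `j`-th object of the left rotation is `Xⱼ₊₁`, for `j = 0, …, n`. -/
def rotIso (X : Seq S n) (j : Fin (n + 1)) : X.rotObj j.castSucc ≅ X.obj j.succ :=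
  eqToIso (by simp [rotObj])

/-- The last object of the left rotation is `Σ X₀`. -/
def rotIsoLast (X : Seq S n) : X.rotObj (Fin.last (n + 1)) ≅ S.obj (X.obj 0) :=
  eqToIso (by simp [rotObj])

/-- The left rotation `X₁ ⟶ X₂ ⟶ ⋯ ⟶ Xₙ₊₁ ⟶ Σ X₀ ⟶ Σ X₁`, whose connecting morphism is
`(-1)ⁿ Σ(X₀ ⟶ X₁)`. -/
def rotate (X : Seq S n) : Seq S n where
  obj := X.rotObj
  map := Fin.lastCases
    ((X.rotIso (Fin.last n)).hom ≫ X.last ≫ X.rotIsoLast.inv)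
    (fun j => (X.rotIso j.castSucc).hom ≫ X.map j.succ ≫ (X.rotIso j.succ).inv)
  last := (-1 : ℤ) ^ n • (X.rotIsoLast.hom ≫ S.map (X.first ≫ (X.rotIso 0).inv))

/-- The mapping cone of `φ : X ⟶ Y`,
`X₁ ⊞ Y₀ ⟶ X₂ ⊞ Y₁ ⟶ ⋯ ⟶ Σ X₀ ⊞ Yₙ₊₁ ⟶ Σ (X₁ ⊞ Y₀)`. With `α`, `β` the morphisms of `X`, `Y`,
its `i`-th morphism has components `-αᵢ₊₁`, `φᵢ₊₁` and `βᵢ`; the last one has components `-Σ α₀`,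
`Σ φ₀` and the connecting morphism of `Y`. -/
def cone [HasBinaryBiproducts C] {X Y : Seq S n} (φ : Hom X Y) : Seq S n where
  obj i := X.rotate.obj i ⊞ Y.obj i
  map i := biprod.desc
    (biprod.lift (-X.rotate.map i) ((X.rotIso i).hom ≫ φ.app i.succ))
    (Y.map i ≫ biprod.inr)
  last := biprod.desc
    (X.rotIsoLast.hom ≫
      (-S.map (X.first ≫ (X.rotIso 0).inv ≫
          (biprod.inl : X.rotate.obj 0 ⟶ X.rotate.obj 0 ⊞ Y.obj 0))
        + S.map (φ.app 0 ≫ (biprod.inr : Y.obj 0 ⟶ X.rotate.obj 0 ⊞ Y.obj 0))))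
    (Y.last ≫ S.map biprod.inr)

end Seq

/-- An `(n+2)`-angulation of `(C, Σ)` in the sense of Geiss, Keller and Oppermann. -/
structure Angulation [HasZeroObject C] [HasBinaryBiproducts C] (S : C ⥤ C) (n : ℕ) where
  /-- the `(n+2)`-angles -/
  IsAngle : Seq S n → Prop
  /-- (F1)(a) the angles are closed under isomorphisms, direct sums and direct summands -/
  of_iso : ∀ {X Y : Seq S n} (φ : Seq.Hom X Y), (∀ i, IsIso (φ.app i)) → IsAngle X → IsAngle Y
  sum : ∀ {X Y : Seq S n}, IsAngle X → IsAngle Y → IsAngle (X.sum Y)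
  of_sum : ∀ {X Y : Seq S n}, IsAngle (X.sum Y) → IsAngle X
  /-- (F1)(b) trivial sequences are angles -/
  trivial : ∀ A : C, IsAngle (Seq.trivial S n A)
  /-- (F1)(c) every morphism is the first morphism of an angle -/
  complete : ∀ {A B : C} (f : A ⟶ B), ∃ X : Seq S n, IsAngle X ∧
    Nonempty (Arrow.mk X.first ≅ Arrow.mk f)
  /-- (F2) a sequence is an angle if and only if its left rotation is -/
  rotate : ∀ X : Seq S n, IsAngle X ↔ IsAngle X.rotate
  /-- (F3) and (F4): a commutative square on the first morphisms of two angles extends to a morphism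
  of sequences, which can be chosen so that its mapping cone is an angle -/
  extend : ∀ {X Y : Seq S n}, IsAngle X → IsAngle Y →
    ∀ (a : X.obj 0 ⟶ Y.obj 0) (b : X.obj (Fin.succ 0) ⟶ Y.obj (Fin.succ 0)),
      X.first ≫ b = a ≫ Y.first →
      ∃ φ : Seq.Hom X Y, φ.app 0 = a ∧ φ.app (Fin.succ 0) = b ∧
        IsAngle (Seq.cone φ)

/-- `InAdd M X`: the object `X` lies in `add M`, i.e. `X` is a direct summand of a direct sum of
finitely many copies of `M`. (In an idempotent complete category, direct summands are the same as
retracts.) -/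
def InAdd [HasFiniteBiproducts C] (M X : C) : Prop :=
  ∃ r : ℕ, Nonempty (Retract X (⨁ fun _ : Fin r => M))

/-- Oppermann-Thomas cluster tilting objects. -/
structure IsClusterTilting [HasZeroObject C] [HasBinaryBiproducts C] [HasFiniteBiproducts C]
    {S : C ⥤ C} {n : ℕ} (𝒩 : Angulation S n) (T : C) : Prop where
  rigid : ∀ f : T ⟶ S.obj T, f = 0
  exists_angle : ∀ X : C, ∃ Z : Seq S n, 𝒩.IsAngle Z ∧
    (∀ i : Fin (n + 1), InAdd T (Z.obj i.castSucc)) ∧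
    Nonempty (Z.obj (Fin.last (n + 1)) ≅ X)

/-! ### Relative rigidity -/

variable [HasBinaryBiproducts C] [HasFiniteBiproducts C] (S : C ⥤ C) (T : C)

/-- `[ΣT](X, Y) = 0`: every morphism `X ⟶ Y` that factors through an object of `add ΣT` is zero. -/
def FactorZero (X Y : C) : Prop :=
  ∀ (Z : C), InAdd (S.obj T) Z → ∀ (f : X ⟶ Z) (g : Z ⟶ Y), f ≫ g = 0

/-- `X` is `ΣT`-`n`-rigid. -/
def IsRelRigid (X : C) : Prop := FactorZero S T X (S.obj X)

/-- `X` is maximal `ΣT`-`n`-rigid. -/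
def IsMaxRelRigid (X : C) : Prop :=
  IsRelRigid S T X ∧ ∀ M : C, IsRelRigid S T (X ⊞ M) → InAdd X M

/-- `X` is `ΣT`-`n`-self-perpendicular. -/
def IsRelSelfPerp (X : C) : Prop :=
  ∀ M : C, InAdd X M ↔ (FactorZero S T X (S.obj M) ∧ FactorZero S T M (S.obj X))

/-- `M ≅ M₀ ⊞ Σ T_M` with `T_M ∈ add T`, where `Σ T_M` is a maximal direct summand of `M` in
`add ΣT`: the complement `M₀` has no nonzero direct summand in `add ΣT`. -/
structure IsDecomposition (M M₀ TM : C) : Prop where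
  iso : Nonempty (M ≅ M₀ ⊞ S.obj TM)
  mem : InAdd T TM
  maximal : ∀ X : C, Nonempty (Retract X M₀) → InAdd (S.obj T) X → IsZero X

end Angulated

/-! ### The higher Auslander-Reiten translation

Right modules over an algebra `Λ` are left modules over `A = Λᵐᵒᵖ`, and `FGModuleCat A` is the
category of finitely generated left `A`-modules. -/

namespace TauTilting

section ProjectiveCover

variable {A : Type v} [Ring A]

/-- A surjection `p : P → M` from a projective module whose kernel is superfluous. -/
structure IsProjectiveCover {P M : FGModuleCat.{v} A} (p : P →ₗ[A] M) : Prop where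
  projective : Module.Projective A P
  surjective : Function.Surjective p
  superfluous : ∀ N : Submodule A P, N ⊔ LinearMap.ker p = ⊤ → N = ⊤

theorem exists_isProjectiveCover [IsArtinianRing A] (M : FGModuleCat.{v} A) :
    ∃ (P : FGModuleCat.{v} A) (p : P →ₗ[A] M), IsProjectiveCover p := by
  obtain ⟨r, π, hπ⟩ := Module.Finite.exists_fin' A M
  let s : Set (Submodule A (Fin r → A)) :=
    {N | Module.Projective A N ∧ Function.Surjective (π ∘ₗ N.subtype)}
  have hs : s.Nonempty := by
    refine ⟨⊤, Module.Projective.of_equiv (Submodule.topEquiv (R := A) (M := Fin r → A)).symm, ?_⟩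
    intro m
    obtain ⟨x, hx⟩ := hπ m
    exact ⟨⟨x, trivial⟩, hx⟩
  obtain ⟨N, ⟨hNp, hNs⟩, hmin⟩ := WellFounded.has_min
    (IsWellFounded.wf (r := ((· < ·) : Submodule A (Fin r → A) → _ → Prop))) s hs
  have := hNp
  let p : N →ₗ[A] M := π ∘ₗ N.subtype
  refine ⟨FGModuleCat.of A N, p, hNp, hNs, ?_⟩
  intro L hL
  change Submodule A N at L
  have hLs : Function.Surjective (p ∘ₗ L.subtype) := by
    intro m
    obtain ⟨x, hx⟩ := hNs m
    have hxt : x ∈ L ⊔ LinearMap.ker p := by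
      have : x ∈ (⊤ : Submodule A N) := trivial
      rw [← hL] at this
      exact this
    obtain ⟨y, hy, z, hz, rfl⟩ := Submodule.mem_sup.1 hxt
    refine ⟨⟨y, hy⟩, ?_⟩
    rw [← hx]
    have hz' : p z = 0 := hz
    change p y = p (y + z)
    rw [map_add, hz', add_zero]
  obtain ⟨g, hg⟩ := Module.projective_lifting_property (p ∘ₗ L.subtype) p hLs
  let e : Module.End A N := L.subtype ∘ₗ g
  have he : p ∘ₗ e = p := hg
  have hpow : ∀ m x, p ((e ^ m) x) = p x := by
    intro m
    induction m with
    | zero => intro x; rfl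
    | succ m ih =>
      intro x
      rw [pow_succ, Module.End.mul_apply, ih]
      exact LinearMap.congr_fun he x
  obtain ⟨m, hm⟩ := Filter.eventually_atTop.1 (LinearMap.eventually_isCompl_ker_pow_range_pow e)
  have hc := hm (m + 1) (Nat.le_succ m)
  set R := LinearMap.range (e ^ (m + 1)) with hR
  have hRp : Module.Projective A R :=
    Module.Projective.of_split R.subtype
      (Submodule.projectionOnto _ _ hc.symm)
      (LinearMap.ext fun x => Submodule.projectionOnto_apply_left hc.symm x)
  have hRs : R.map N.subtype ∈ s := by
    refine ⟨Module.Projective.of_equiv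
      (Submodule.equivMapOfInjective N.subtype N.injective_subtype R), ?_⟩
    intro y
    obtain ⟨x, hx⟩ := hNs y
    exact ⟨⟨N.subtype ((e ^ (m + 1)) x), Submodule.mem_map_of_mem ⟨x, rfl⟩⟩,
      (hpow (m + 1) x).trans hx⟩
  have hle : R.map N.subtype ≤ N := Submodule.map_subtype_le N R
  have heq : R.map N.subtype = N := by
    by_contra hne
    exact hmin _ hRs (lt_of_le_of_ne hle hne)
  rw [eq_top_iff]
  intro x _
  have hx : (x : Fin r → A) ∈ R.map N.subtype := by rw [heq]; exact x.2
  obtain ⟨y, hy, hyx⟩ := Submodule.mem_map.1 hx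
  obtain rfl : y = x := Subtype.ext hyx
  obtain ⟨z, hz⟩ := hy
  rw [← hz, pow_succ', Module.End.mul_apply]
  exact (g _).2

end ProjectiveCover

section Translation

variable (k : Type w) [Field k] {A : Type v} [Ring A] [Algebra k A]

/-- The module `D Hom_A(P, A)` underlying the Nakayama functor, where `D = Hom_k(-, k)`. -/
def Nakayama (P : Type v) [AddCommGroup P] [Module A P] : Type (max v w) :=
  (P →ₗ[A] A) →ₗ[k] k

namespace Nakayama

variable {P Q : Type v} [AddCommGroup P] [Module A P] [AddCommGroup Q] [Module A Q]

instance : AddCommGroup (Nakayama k (A := A) P) :=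
  inferInstanceAs (AddCommGroup ((P →ₗ[A] A) →ₗ[k] k))

/-- `Hom_A(P, A)` is a right `A`-module through `(f a)(x) = f(x) a`, so that its dual is a left
`A`-module through `(a φ)(f) = φ(f a)`. -/
instance : Module A (Nakayama k (A := A) P) where
  smul a φ :=
    ({ toFun := fun f => φ.toFun (MulOpposite.op a • f)
       map_add' := by
        intro f g; rw [smul_add]; exact φ.map_add' _ _
       map_smul' := by
        intro c f; rw [smul_comm]; exact φ.map_smul' _ _ } : (P →ₗ[A] A) →ₗ[k] k)
  one_smul φ := by
    refine LinearMap.ext (fun f => ?_)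
    change φ.toFun (MulOpposite.op 1 • f) = φ.toFun f
    rw [MulOpposite.op_one, one_smul]
  mul_smul a b φ := by
    refine LinearMap.ext (fun f => ?_)
    change φ.toFun (MulOpposite.op (a * b) • f)
      = φ.toFun (MulOpposite.op b • MulOpposite.op a • f)
    rw [MulOpposite.op_mul, mul_smul]
  smul_zero a := rfl
  smul_add a φ ψ := rfl
  add_smul a b φ := by
    refine LinearMap.ext (fun f => ?_)
    change φ.toFun (MulOpposite.op (a + b) • f)
      = φ.toFun (MulOpposite.op a • f) + φ.toFun (MulOpposite.op b • f)
    rw [MulOpposite.op_add, add_smul]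
    exact φ.map_add' _ _
  zero_smul φ := by
    refine LinearMap.ext (fun f => ?_)
    change φ.toFun (MulOpposite.op 0 • f) = 0
    rw [MulOpposite.op_zero, zero_smul]
    exact LinearMap.map_zero φ

/-- The action of the Nakayama functor on morphisms: `(ν g)(φ)(f) = φ(f ∘ g)`. -/
def map (g : P →ₗ[A] Q) : Nakayama k (A := A) P →ₗ[A] Nakayama k (A := A) Q where
  toFun φ :=
    ({ toFun := fun f => φ.toFun (f ∘ₗ g)
       map_add' := fun f f' => φ.map_add' (f ∘ₗ g) (f' ∘ₗ g)
       map_smul' := fun c f => φ.map_smul' c (f ∘ₗ g) } : (Q →ₗ[A] A) →ₗ[k] k)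
  map_add' _ _ := rfl
  map_smul' _ _ := rfl

end Nakayama

theorem exists_cover (k : Type w) [Field k] {A : Type v} [Ring A] [Algebra k A]
    [Module.Finite k A] (M : FGModuleCat.{v} A) :
    ∃ (P : FGModuleCat.{v} A) (p : P →ₗ[A] M), IsProjectiveCover p := by
  have : IsArtinianRing A := IsArtinianRing.of_finite k A
  exact exists_isProjectiveCover M

variable [Module.Finite k A]

/-- The projective cover of `M`. -/
def cover (M : FGModuleCat.{v} A) : FGModuleCat.{v} A := (exists_cover k M).choose

/-- The surjection from the projective cover of `M` onto `M`. -/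
def coverMap (M : FGModuleCat.{v} A) : cover k M →ₗ[A] M := (exists_cover k M).choose_spec.choose

theorem coverMap_isProjectiveCover (M : FGModuleCat.{v} A) : IsProjectiveCover (coverMap k M) :=
  (exists_cover k M).choose_spec.choose_spec

theorem finite_ker_coverMap (M : FGModuleCat.{v} A) :
    Module.Finite A (LinearMap.ker (coverMap k M)) := by
  have : IsArtinianRing A := IsArtinianRing.of_finite k A
  infer_instance

/-- The syzygy `Ω M`, the kernel of the projective cover of `M`. -/
def syzygy (M : FGModuleCat.{v} A) : FGModuleCat.{v} A :=
  haveI := finite_ker_coverMap k M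
  FGModuleCat.of A (LinearMap.ker (coverMap k M))

/-- The second map `P₁ → P₀` of the minimal projective presentation `P₁ → P₀ → M → 0`. -/
def presentationMap (M : FGModuleCat.{v} A) : cover k (syzygy k M) →ₗ[A] cover k M :=
  (LinearMap.ker (coverMap k M)).subtype ∘ₗ coverMap k (syzygy k M)

/-- The Auslander-Reiten translate `τ M`, the kernel of `D Hom_A(P₁, A) → D Hom_A(P₀, A)` for the
minimal projective presentation `P₁ → P₀ → M → 0`. -/
def tau (M : FGModuleCat.{v} A) : Submodule A (Nakayama k (A := A) (cover k (syzygy k M))) :=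
  LinearMap.ker (Nakayama.map k (presentationMap k M))

/-- The `n`-Auslander-Reiten translate `τₙ M = τ Ωⁿ⁻¹ M`, for `n ≥ 1`. It is the kernel of
`D Hom_A(Pₙ, A) → D Hom_A(Pₙ₋₁, A)` for the minimal projective resolution `P` of `M`. -/
def tauN (n : ℕ) (M : FGModuleCat.{v} A) :=
  tau k ((syzygy k)^[n - 1] M)

/-- `Hom_A(M, τₙ N) = 0`. -/
def HomTauZero (n : ℕ) (M N : FGModuleCat.{v} A) : Prop :=
  ∀ f : M →ₗ[A] tauN k n N, f = 0

/-! ### `τₙ`-rigid pairs -/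

/-- `M` is `τₙ`-rigid. -/
def IsTauRigid (n : ℕ) (M : FGModuleCat.{v} A) : Prop := HomTauZero k n M M

/-- For modules, `N ∈ add M`. -/
def ModInAdd (M N : FGModuleCat.{v} A) : Prop := Angulated.InAdd M.obj N.obj

variable (n : ℕ) (𝒟 : ObjectProperty (FGModuleCat.{v} A))

/-- `(M, P)` is a `τₙ`-rigid pair in `𝒟`. -/
structure IsTauRigidPair (M P : FGModuleCat.{v} A) : Prop where
  mem : 𝒟 M
  projective : Module.Projective A P
  rigid : IsTauRigid k n M
  hom_zero : ∀ f : P →ₗ[A] M, f = 0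

/-- `(M, P)` is a support `τₙ`-tilting pair in `𝒟`. -/
structure IsSupportTauTiltingPair (M P : FGModuleCat.{v} A) : Prop where
  rigidPair : IsTauRigidPair k n 𝒟 M P
  maximal : ∀ N : FGModuleCat.{v} A, 𝒟 N →
    IsTauRigidPair k n 𝒟 (FGModuleCat.of A (M × N)) P → ModInAdd M N
  support : ∀ Q : FGModuleCat.{v} A, Module.Projective A Q →
    (ModInAdd P Q ↔ ∀ f : Q →ₗ[A] M, f = 0)

/-- `(M, P)` is a maximal `τₙ`-rigid pair in `𝒟`. -/
structure IsMaxTauRigidPair (M P : FGModuleCat.{v} A) : Prop where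
  mem : 𝒟 M
  projective : Module.Projective A P
  maximal : ∀ N : FGModuleCat.{v} A, 𝒟 N →
    (ModInAdd M N ↔ HomTauZero k n M N ∧ HomTauZero k n N M ∧ ∀ f : P →ₗ[A] N, f = 0)
  support : ∀ Q : FGModuleCat.{v} A, Module.Projective A Q →
    (ModInAdd P Q ↔ ∀ f : Q →ₗ[A] M, f = 0)

end Translation

/-! ### The functor `C(T, -)` -/

section Functor

variable (k : Type w) [Field k] {C : Type u} [Category.{v} C] [Preadditive C] [Linear k C]
  [∀ X Y : C, Module.Finite k (X ⟶ Y)]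

instance finite_end (T : C) : Module.Finite k (End T) :=
  inferInstanceAs (Module.Finite k (T ⟶ T))

instance finite_end_op (T : C) : Module.Finite k (End T)ᵐᵒᵖ :=
  Module.Finite.equiv (MulOpposite.opLinearEquiv k : End T ≃ₗ[k] (End T)ᵐᵒᵖ)

theorem finite_coyoneda (k : Type w) [Field k] {C : Type u} [Category.{v} C] [Preadditive C]
    [Linear k C] [∀ X Y : C, Module.Finite k (X ⟶ Y)] (T X : C) :
    Module.Finite (End T)ᵐᵒᵖ ((preadditiveCoyonedaObj T).obj X) := by
  obtain ⟨s, hs⟩ := (inferInstance : Module.Finite k (T ⟶ X)).fg_top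
  refine ⟨Submodule.fg_def.2 ⟨(s : Set (T ⟶ X)), s.finite_toSet, ?_⟩⟩
  rw [eq_top_iff]
  intro x _
  have hx : (x : T ⟶ X) ∈ Submodule.span k (s : Set (T ⟶ X)) := by rw [hs]; trivial
  refine Submodule.span_induction (p := fun (y : T ⟶ X) _ =>
    (show (preadditiveCoyonedaObj T).obj X from y) ∈ Submodule.span (End T)ᵐᵒᵖ
      (s : Set (T ⟶ X))) ?_ ?_ ?_ ?_ hx
  · intro y hy
    exact Submodule.subset_span hy
  · exact Submodule.zero_mem _
  · intro y z _ _ hy hz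
    exact Submodule.add_mem _ hy hz
  · intro c y _ hy
    have h : c • y = (c • 𝟙 T : T ⟶ T) ≫ y := by
      rw [Linear.smul_comp, Category.id_comp]
    rw [h]
    exact Submodule.smul_mem _ (MulOpposite.op (End.of (c • 𝟙 T : T ⟶ T))) hy

/-- The functor `C(T, -)` from `C` to finitely generated right `End(T)`-modules. -/
def homFunctor (T : C) : C ⥤ FGModuleCat.{v} (End T)ᵐᵒᵖ :=
  (ModuleCat.isFG (End T)ᵐᵒᵖ).lift (preadditiveCoyonedaObj T) (finite_coyoneda k T)

/-- The essential image of `C(T, -)`. -/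
def imageD (T : C) : ObjectProperty (FGModuleCat.{v} (End T)ᵐᵒᵖ) := (homFunctor k T).essImage

end Functor

end TauTilting

/-- The isomorphism class of an object. -/
def isoClass {C : Type u} [Category.{v} C] (X : C) : Quotient (isIsomorphicSetoid C) :=
  Quotient.mk _ X
end

/-! Write `Σ` for the suspension and `Λ` for `End T`. The functor `C(T, -)` is full, and its kernel
is the ideal of morphisms factoring through `add ΣT` (`exists_lift`,
`mem_through_of_postcomp_eq_zero`): the resolving angle of `X` ends in an exact `T₁ ⟶ T₀ ⟶ X ⟶ ΣU`,
and `C(T, ΣU) = 0` makes `C(T, T₁) → C(T, T₀) → C(T, X) → 0` a projective presentation. If `X` has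
no summand in `add ΣT`, then by Hom-finiteness its endomorphisms in that ideal are nilpotent, so
`C(T, -)` detects isomorphism between such objects. It also identifies `add T` with the projectives.
Hence `M₀ ⊞ ΣT_M ↦ (C(T, M₀), C(T, T_M))` is a bijection from all isomorphism classes onto pairs
(module in the image, projective), and (b), (c), (d) only require the conditions to match on both
sides.

The heart is `homTauZero_iff_factorZero`: `Hom(M, τₙN) = 0` if and only if `[ΣT](N₀, ΣM₀) = 0`. In a
resolving angle `Z₀ ⟶ Z₁ ⟶ ⋯ ⟶ N₀ ⟶ ΣZ₀`, every map `N₀ ⟶ ΣT` factors through the connecting map, so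
the right side says that every `Z₀ ⟶ M₀` extends along `Z₀ ⟶ Z₁`. By Nakayama duality the left side
says that every `Pₙ → M` extends along `Pₙ → Pₙ₋₁`. Both are extension problems over projective
presentations of stably equal modules, and `IsStableRetract.extend` transports one to the other.
That transport needs minimality only at the source of the map, and for `Z₀` this is the absence of
`ΣT`-summands in `N₀`.

Krull-Schmidt arguments are replaced throughout by one principle, `AddDisjoint.isNilpotent`: an
endomorphism lying in the ideals of two disjoint additive closures is nilpotent. -/

noncomputable section

/-! ### Exactness of consecutive morphisms in an angle. -/

namespace Angulated

variable {C : Type u} [Category.{v} C] [Preadditive C]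

namespace Seq

variable {S : C ⥤ C} {n : ℕ}

theorem rotate_map_castSucc (X : Seq S n) (j : Fin n) :
    X.rotate.map j.castSucc = (X.rotIso j.castSucc).hom ≫ X.map j.succ ≫ (X.rotIso j.succ).inv := by
  simp [rotate]

theorem rotate_map_last (X : Seq S n) :
    X.rotate.map (Fin.last n) = (X.rotIso (Fin.last n)).hom ≫ X.last ≫ X.rotIsoLast.inv := by
  simp [rotate]

theorem rotate_last (X : Seq S n) :
    X.rotate.last = (-1 : ℤ) ^ n • (X.rotIsoLast.hom ≫ S.map (X.first ≫ (X.rotIso 0).inv)) := rfl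

/-- `f ≫ g = 0`, every morphism killed by `g` factors through `f`, and every morphism killing `f`
factors through `g`. -/
structure ExactPair {A B D : C} (f : A ⟶ B) (g : B ⟶ D) : Prop where
  zero : f ≫ g = 0
  lift : ∀ {W : C} (h : W ⟶ B), h ≫ g = 0 → ∃ l : W ⟶ A, l ≫ f = h
  desc : ∀ {W : C} (h : B ⟶ W), f ≫ h = 0 → ∃ l : D ⟶ W, g ≫ l = h

theorem ExactPair.of_conj {A B D A' B' D' : C} {f : A ⟶ B} {g : B ⟶ D} {f' : A' ⟶ B'} {g' : B' ⟶ D'}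
    (a : A' ≅ A) (b : B' ≅ B) (d : D' ≅ D) (hf : f' = a.hom ≫ f ≫ b.inv)
    (hg : g' = b.hom ≫ g ≫ d.inv) (h : ExactPair f' g') : ExactPair f g := by
  have hf' : f = a.inv ≫ f' ≫ b.hom := by simp [hf]
  have hg' : g = b.inv ≫ g' ≫ d.hom := by simp [hg]
  refine ⟨?_, ?_, ?_⟩
  · rw [hf', hg']; simp [reassoc_of% h.zero]
  · intro W k hk
    obtain ⟨l, hl⟩ := h.lift (k ≫ b.inv) (by simp [hg, reassoc_of% hk])
    exact ⟨l ≫ a.hom, by rw [hf']; simp [reassoc_of% hl]⟩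
  · intro W k hk
    obtain ⟨l, hl⟩ := h.desc (b.hom ≫ k) (by simp [hf, hk])
    exact ⟨d.inv ≫ l, by rw [hg']; simp [hl]⟩

theorem ExactPair.comp_iso {A B D B' : C} {f : A ⟶ B} {g : B ⟶ D} (e : B ≅ B')
    (h : ExactPair f g) : ExactPair (f ≫ e.hom) (e.inv ≫ g) :=
  ExactPair.of_conj (Iso.refl A) e (Iso.refl D) (by simp) (by simp) h

theorem ExactPair.comp_iso_right {A B D D' : C} {f : A ⟶ B} {g : B ⟶ D} (e : D ≅ D')
    (h : ExactPair f g) : ExactPair f (g ≫ e.hom) :=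
  ExactPair.of_conj (Iso.refl A) (Iso.refl B) e (by simp) (by simp) h

theorem ExactPair.of_zsmul {A B D : C} {f : A ⟶ B} {g : B ⟶ D} {m : ℤ} (hm : m * m = 1)
    (h : ExactPair f (m • g)) : ExactPair f g := by
  have hg : g = m • m • g := by rw [smul_smul, hm, one_smul]
  refine ⟨?_, ?_, ?_⟩
  · rw [hg, Preadditive.comp_zsmul, h.zero, smul_zero]
  · intro W k hk
    exact h.lift k (by rw [Preadditive.comp_zsmul, hk, smul_zero])
  · intro W k hk
    obtain ⟨l, hl⟩ := h.desc k hk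
    exact ⟨m • l, by rw [← hl, Preadditive.comp_zsmul, Preadditive.zsmul_comp]⟩

section Shifted

variable [HasZeroObject C]

omit [Preadditive C] in
theorem isZero_trivialObj (n : ℕ) (A : C) (i : Fin n) : IsZero (trivialObj n A i.succ.succ) :=
  isZero_zero C

/-- The sequence `0 ⟶ A = A ⟶ 0 ⟶ ⋯ ⟶ 0`. -/
def shifted (S : C ⥤ C) (m : ℕ) (A : C) : Seq S (m + 1) where
  obj := Fin.cases (0 : C) (trivialObj m A)
  map := Fin.cases (motive := fun i =>
      (Fin.cases (motive := fun _ => C) (0 : C) (trivialObj m A) (Fin.castSucc i) : C) ⟶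
        (Fin.cases (motive := fun _ => C) (0 : C) (trivialObj m A) (Fin.succ i) : C))
    (0 : (0 : C) ⟶ A) (fun j => (trivial S m A).map j)
  last := 0

omit [Preadditive C] in
theorem trivialObj_castSucc (m : ℕ) (A : C) (i : Fin (m + 2)) :
    trivialObj (m + 1) A i.castSucc = trivialObj m A i := by
  refine Fin.cases rfl (fun j => ?_) i
  refine Fin.cases rfl (fun j => ?_) j
  rfl

theorem isZero_shifted_rotObj_last (S : C ⥤ C) [S.Additive] (m : ℕ) (A : C) :
    IsZero ((shifted S m A).rotObj (Fin.last (m + 2))) :=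
  (S.map_isZero (isZero_zero C)).of_iso (shifted S m A).rotIsoLast

/-- The comparison of a trivial sequence with the rotation of a shifted one. -/
def trivialToRotate (S : C ⥤ C) [S.Additive] (m : ℕ) (A : C) :
    Hom (trivial S (m + 1) A) (shifted S m A).rotate where
  app := Fin.lastCases 0 (fun j => eqToHom (trivialObj_castSucc m A j) ≫
    ((shifted S m A).rotIso j).inv)
  comm i := by
    refine Fin.lastCases ?_ (fun j => ?_) i
    · exact (isZero_shifted_rotObj_last S m A).eq_of_tgt _ _
    · rw [rotate_map_castSucc]
      simp only [Fin.succ_castSucc, Fin.lastCases_castSucc]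
      have key : (trivial S (m + 1) A).map j.castSucc ≫ eqToHom (trivialObj_castSucc m A j.succ) =
          eqToHom (trivialObj_castSucc m A j.castSucc) ≫ (shifted S m A).map j.succ := by
        refine Fin.cases ?_ (fun j => ?_) j
        · rfl
        · exact (isZero_trivialObj m A j).eq_of_tgt _ _
      have e : ((shifted S m A).rotIso j.castSucc).inv ≫ ((shifted S m A).rotIso j.castSucc).hom ≫
          (shifted S m A).map j.succ ≫ ((shifted S m A).rotIso j.succ).inv =
          (shifted S m A).map j.succ ≫ ((shifted S m A).rotIso j.succ).inv :=
        Iso.inv_hom_id_assoc _ _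
      refine (Category.assoc _ _ _).symm.trans ?_
      refine (congrArg (· ≫ ((shifted S m A).rotIso j.succ).inv) key).trans ?_
      refine (Category.assoc _ _ _).trans ?_
      refine (congrArg (eqToHom (trivialObj_castSucc m A j.castSucc) ≫ ·) e).symm.trans ?_
      exact (Category.assoc _ _ _).symm
  comm_last := by
    rw [Fin.lastCases_last, zero_comp]
    exact zero_comp

theorem isIso_trivialToRotate_app (S : C ⥤ C) [S.Additive] (m : ℕ) (A : C) (i : Fin (m + 3)) :
    IsIso ((trivialToRotate S m A).app i) := by
  refine Fin.lastCases ?_ (fun j => ?_) i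
  · exact ⟨0, (isZero_zero C).eq_of_src _ _, (isZero_shifted_rotObj_last S m A).eq_of_src _ _⟩
  · simp only [trivialToRotate, Fin.lastCases_castSucc]
    exact ((eqToIso (trivialObj_castSucc m A j)) ≪≫ ((shifted S m A).rotIso j).symm).isIso_hom

end Shifted

end Seq

section Exact

open Angulated.Seq

variable [HasZeroObject C] [HasBinaryBiproducts C] {S : C ⥤ C} [S.Additive]

/-- The left rotation is isomorphic to the trivial angle, and (F2) also holds backwards. Morphisms
of angles into this one produce factorizations through weak cokernels. -/
theorem Angulation.shifted_isAngle {m : ℕ} (𝒩 : Angulation S (m + 1)) (A : C) :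
    𝒩.IsAngle (shifted S m A) :=
  (𝒩.rotate _).2 (𝒩.of_iso (trivialToRotate S m A) (isIso_trivialToRotate_app S m A)
    (𝒩.trivial A))

-- Strips the signs and the rotation isomorphisms from the last square of a morphism between two
-- rotated sequences.
omit [HasZeroObject C] [HasBinaryBiproducts C] [S.Additive] in
theorem map_eq_of_comm {W X₀ X₁ R R' V V' : C} (i : V ≅ S.obj W) (p : R ≅ W)
    (i' : V' ≅ S.obj X₀) (p' : R' ≅ X₁) {h : W ⟶ X₁} {f : X₀ ⟶ X₁} {ψ : V ⟶ V'} {m : ℤ}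
    (hm : m * m = 1)
    (hc : (m • (i.hom ≫ S.map (𝟙 W ≫ p.inv))) ≫ S.map (p.hom ≫ h ≫ p'.inv) =
      ψ ≫ (m • (i'.hom ≫ S.map (f ≫ p'.inv)))) :
    S.map h = (i.inv ≫ ψ ≫ i'.hom) ≫ S.map f := by
  rw [Preadditive.zsmul_comp, Preadditive.comp_zsmul] at hc
  have h4 := congrArg (fun t => i.inv ≫ (m • t) ≫ S.map p'.hom) hc
  simp only [smul_smul, hm, one_smul] at h4
  simpa [← Functor.map_comp] using h4

theorem Angulation.exactPair_zero [S.Full] [S.Faithful] {m : ℕ} (𝒩 : Angulation S (m + 1))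
    {X : Seq S (m + 1)} (hX : 𝒩.IsAngle X) :
    ExactPair (X.map (0 : Fin (m + 1)).castSucc) (X.map (0 : Fin (m + 1)).succ) := by
  refine ⟨?_, ?_, ?_⟩
  -- In a morphism from the trivial angle on `X₀`, the second square passes through a zero object.
  · obtain ⟨φ, h0, h1, -⟩ := 𝒩.extend (𝒩.trivial (X.obj 0)) hX (𝟙 _) X.first rfl
    have h := φ.comm (0 : Fin (m + 1)).succ
    have h1' : φ.app (0 : Fin (m + 1)).succ.castSucc = X.map (0 : Fin (m + 1)).castSucc := h1
    rw [h1'] at h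
    exact h.symm.trans zero_comp
  · intro W h hh
    -- The rotated trivial angle is `W ⟶ 0 ⟶ ⋯ ⟶ ΣW`. Extending `(h, 0)` gives a last component `ΣW
    -- ⟶ ΣX₀`, and the last square says that its preimage under `S` lifts `h`.
    obtain ⟨φ, h0, h1, -⟩ := 𝒩.extend ((𝒩.rotate _).1 (𝒩.trivial W)) ((𝒩.rotate _).1 hX)
      (((Seq.trivial S (m + 1) W).rotIso 0).hom ≫ h ≫ (X.rotIso 0).inv) 0 (by
        have e : X.rotate.first = _ := X.rotate_map_castSucc (0 : Fin (m + 1))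
        rw [comp_zero, e]
        have hh' : h ≫ X.map (0 : Fin (m + 1)).succ ≫ (X.rotIso (0 : Fin (m + 1)).succ).inv = 0 := by
          rw [← Category.assoc, hh, zero_comp]
        have e2 : (X.rotIso 0).inv ≫ (X.rotIso 0).hom ≫ X.map (0 : Fin (m + 1)).succ ≫
            (X.rotIso (0 : Fin (m + 1)).succ).inv =
            X.map (0 : Fin (m + 1)).succ ≫ (X.rotIso (0 : Fin (m + 1)).succ).inv :=
          Iso.inv_hom_id_assoc _ _
        refine Eq.symm ?_
        refine (Category.assoc _ _ _).trans ?_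
        refine (congrArg (((Seq.trivial S (m + 1) W).rotIso 0).hom ≫ ·)
          ((Category.assoc _ _ _).trans ((congrArg (h ≫ ·) e2).trans hh'))).trans comp_zero)
    have h2 := φ.comm_last
    rw [h0, rotate_last, rotate_last] at h2
    have e : (Seq.trivial S (m + 1) W).first = 𝟙 W := rfl
    rw [e] at h2
    have h3 : S.map h = ((Seq.trivial S (m + 1) W).rotIsoLast.inv ≫ φ.app (Fin.last _) ≫
        X.rotIsoLast.hom) ≫ S.map X.first := by
      exact map_eq_of_comm _ _ _ _ (by rw [← mul_pow]; simp) h2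
    refine ⟨S.preimage ((Seq.trivial S (m + 1) W).rotIsoLast.inv ≫ φ.app (Fin.last _) ≫
        X.rotIsoLast.hom), S.map_injective ?_⟩
    rw [S.map_comp, S.map_preimage]
    exact h3.symm
  · intro W h hh
    -- Against `0 ⟶ W = W ⟶ 0 ⟶ ⋯` the component at `X₂` is the required factorization of `h`.
    obtain ⟨φ, h0, h1, -⟩ := 𝒩.extend hX (𝒩.shifted_isAngle W) 0 h (by
      rw [zero_comp]; exact hh)
    refine ⟨φ.app (0 : Fin (m + 1)).succ.succ, (φ.comm (0 : Fin (m + 1)).succ).trans ?_⟩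
    have h1' : φ.app (0 : Fin (m + 1)).succ.castSucc = h := h1
    rw [h1']
    exact Category.comp_id _

theorem Angulation.exactPair [S.Full] [S.Faithful] {m : ℕ} (𝒩 : Angulation S (m + 1))
    (i : Fin (m + 1)) : ∀ {X : Seq S (m + 1)}, 𝒩.IsAngle X →
      ExactPair (X.map i.castSucc) (X.map i.succ) := by
  induction i using Fin.induction with
  | zero => exact fun hX => 𝒩.exactPair_zero hX
  | succ j ih =>
    intro X hX
    exact (ih ((𝒩.rotate X).1 hX)).of_conj (X.rotIso _) (X.rotIso _) (X.rotIso _)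
      (X.rotate_map_castSucc j.castSucc) (X.rotate_map_castSucc j.succ)

theorem Angulation.exactPair_last [S.Full] [S.Faithful] {m : ℕ} (𝒩 : Angulation S (m + 1))
    {X : Seq S (m + 1)} (hX : 𝒩.IsAngle X) :
    ExactPair (X.map (Fin.last (m + 1))) X.last :=
  (𝒩.exactPair (Fin.last m) ((𝒩.rotate X).1 hX)).of_conj (X.rotIso _) (X.rotIso _) X.rotIsoLast
    (X.rotate_map_castSucc _) X.rotate_map_last

/-- This is the last pair of the rotated angle, up to the rotation sign, which does not affect
exactness. -/
theorem Angulation.exactPair_first [S.Full] [S.Faithful] {m : ℕ} (𝒩 : Angulation S (m + 1))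
    {X : Seq S (m + 1)} (hX : 𝒩.IsAngle X) :
    ExactPair X.last (S.map (X.map 0)) := by
  have h := 𝒩.exactPair_last ((𝒩.rotate X).1 hX)
  rw [rotate_map_last, rotate_last] at h
  have h' : ExactPair X.last ((-1 : ℤ) ^ (m + 1) • S.map X.first) :=
by
    refine h.of_conj (X.rotIso (Fin.last (m + 1))) X.rotIsoLast (S.mapIso (X.rotIso 0)) rfl ?_
    rw [Preadditive.zsmul_comp, Preadditive.comp_zsmul, S.map_comp]
    rfl
  exact h'.of_zsmul (by rw [← mul_pow]; simp)

end Exact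

end Angulated

/-! ### The ideal of morphisms through `add M`. -/

namespace Angulated

section Through

variable {C : Type u} [Category.{v} C] [Preadditive C]

/-- The subgroup of morphisms `X ⟶ Y` that are finite sums of morphisms factoring through `M`, that
is, of those factoring through an object of `add M`. -/
def through (M X Y : C) : AddSubgroup (X ⟶ Y) :=
  AddSubgroup.closure {f | ∃ (a : X ⟶ M) (b : M ⟶ Y), a ≫ b = f}

variable {M N X Y Z : C}

theorem comp_mem_through (a : X ⟶ M) (b : M ⟶ Y) : a ≫ b ∈ through M X Y :=
  AddSubgroup.subset_closure ⟨a, b, rfl⟩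

theorem mem_through_self (f : M ⟶ Y) : f ∈ through M M Y := by
  simpa using comp_mem_through (𝟙 M) f

theorem through_comp {f : X ⟶ Y} (hf : f ∈ through M X Y) (g : Y ⟶ Z) :
    f ≫ g ∈ through M X Z := by
  induction hf using AddSubgroup.closure_induction with
  | mem f hf =>
    obtain ⟨a, b, rfl⟩ := hf
    rw [Category.assoc]
    exact comp_mem_through _ _
  | zero => rw [zero_comp]; exact zero_mem _
  | add f g _ _ h1 h2 => rw [Preadditive.add_comp]; exact add_mem h1 h2
  | neg f _ h => rw [Preadditive.neg_comp]; exact neg_mem h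

theorem comp_through {f : X ⟶ Y} (hf : f ∈ through M X Y) (g : Z ⟶ X) :
    g ≫ f ∈ through M Z Y := by
  induction hf using AddSubgroup.closure_induction with
  | mem f hf =>
    obtain ⟨a, b, rfl⟩ := hf
    rw [← Category.assoc]
    exact comp_mem_through _ _
  | zero => rw [comp_zero]; exact zero_mem _
  | add f g _ _ h1 h2 => rw [Preadditive.comp_add]; exact add_mem h1 h2
  | neg f _ h => rw [Preadditive.comp_neg]; exact neg_mem h

theorem comp_comp_eq_zero_of_mem_through {W : C} {f : X ⟶ Y} (hf : f ∈ through M X Y) (u : W ⟶ X)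
    (v : Y ⟶ Z) (h : ∀ (a : W ⟶ M) (b : M ⟶ Z), a ≫ b = 0) : u ≫ f ≫ v = 0 := by
  induction hf using AddSubgroup.closure_induction with
  | mem f hf =>
    obtain ⟨a, b, rfl⟩ := hf
    simpa using h (u ≫ a) (b ≫ v)
  | zero => simp
  | add f g _ _ h1 h2 => simp [h1, h2]
  | neg f _ h => simp [h]

theorem map_mem_through {D : Type*} [Category* D] [Preadditive D] (F : C ⥤ D) [F.Additive]
    {f : X ⟶ Y} (hf : f ∈ through M X Y) : F.map f ∈ through (F.obj M) (F.obj X) (F.obj Y) := by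
  induction hf using AddSubgroup.closure_induction with
  | mem f hf =>
    obtain ⟨a, b, rfl⟩ := hf
    rw [F.map_comp]
    exact comp_mem_through _ _
  | zero => rw [F.map_zero]; exact zero_mem _
  | add f g _ _ h1 h2 => rw [F.map_add]; exact add_mem h1 h2
  | neg f _ h => rw [F.map_neg]; exact neg_mem h

theorem mem_through_of_map {D : Type*} [Category* D] [Preadditive D] (F : C ⥤ D) [F.Additive]
    [F.Full] [F.Faithful] {f : X ⟶ Y} (hf : F.map f ∈ through (F.obj M) (F.obj X) (F.obj Y)) :
    f ∈ through M X Y := by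
  suffices h : ∀ g ∈ through (F.obj M) (F.obj X) (F.obj Y), F.preimage g ∈ through M X Y by
    simpa using h _ hf
  intro g hg
  induction hg using AddSubgroup.closure_induction with
  | mem f hf =>
    obtain ⟨a, b, rfl⟩ := hf
    rw [F.preimage_comp]
    exact comp_mem_through _ _
  | zero =>
    have : F.preimage (0 : F.obj X ⟶ F.obj Y) = 0 := F.map_injective (by simp)
    rw [this]; exact zero_mem _
  | add f g _ _ h1 h2 =>
    have : F.preimage (f + g) = F.preimage f + F.preimage g := F.map_injective (by simp)
    rw [this]; exact add_mem h1 h2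
  | neg f _ h =>
    have : F.preimage (-f) = -F.preimage f := F.map_injective (by simp)
    rw [this]; exact neg_mem h

theorem exists_add_of_mem_through_biprod [HasBinaryBiproducts C] {f : X ⟶ Y}
    (hf : f ∈ through (M ⊞ N) X Y) : ∃ g ∈ through M X Y, ∃ h ∈ through N X Y, f = g + h := by
  induction hf using AddSubgroup.closure_induction with
  | mem f hf =>
    obtain ⟨a, b, rfl⟩ := hf
    refine ⟨_, comp_mem_through (a ≫ biprod.fst) (biprod.inl ≫ b), _,
      comp_mem_through (a ≫ biprod.snd) (biprod.inr ≫ b), ?_⟩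
    have h : a ≫ (biprod.fst ≫ biprod.inl + biprod.snd ≫ biprod.inr) ≫ b = a ≫ b := by
      rw [biprod.total, Category.id_comp]
    rw [← h, Preadditive.add_comp, Preadditive.comp_add]
    simp only [Category.assoc]
  | zero => exact ⟨0, zero_mem _, 0, zero_mem _, by simp⟩
  | add f g _ _ h1 h2 =>
    obtain ⟨a, ha, b, hb, rfl⟩ := h1
    obtain ⟨a', ha', b', hb', rfl⟩ := h2
    exact ⟨_, add_mem ha ha', _, add_mem hb hb', by abel⟩
  | neg f _ h =>
    obtain ⟨a, ha, b, hb, rfl⟩ := h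
    exact ⟨_, neg_mem ha, _, neg_mem hb, by abel⟩

variable [HasFiniteBiproducts C]

/-- A retraction onto `X` from `r` copies of `M` is the same as `r` composites `X ⟶ M ⟶ X` with sum
the identity. Closure properties of `add` thus become ideal arithmetic, and later proofs are
inductions over sums of composites. -/
theorem inAdd_iff_mem_through : InAdd M X ↔ 𝟙 X ∈ through M X X := by
  constructor
  · rintro ⟨r, ⟨ρ⟩⟩
    have h : ∑ j : Fin r, (ρ.i ≫ biproduct.π _ j) ≫ (biproduct.ι (fun _ : Fin r => M) j ≫ ρ.r)
        = 𝟙 X := by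
      have e : ρ.i ≫ (∑ j : Fin r, biproduct.π (fun _ : Fin r => M) j ≫
          biproduct.ι (fun _ : Fin r => M) j) ≫ ρ.r
          = 𝟙 X := by
        rw [biproduct.total, Category.id_comp, ρ.retract]
      rw [← e, Preadditive.sum_comp, Preadditive.comp_sum]
      simp only [Category.assoc]
    rw [← h]
    exact sum_mem fun j _ => comp_mem_through _ _
  · intro h
    have key : ∀ f ∈ through M X X, ∃ (r : ℕ) (a : X ⟶ ⨁ fun _ : Fin r => M)
        (b : (⨁ fun _ : Fin r => M) ⟶ X), a ≫ b = f := by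
      intro f hf
      have : ∃ (r : ℕ) (a : Fin r → (X ⟶ M)) (b : Fin r → (M ⟶ X)), ∑ j, a j ≫ b j = f := by
        induction hf using AddSubgroup.closure_induction with
        | mem f hf =>
          obtain ⟨a, b, rfl⟩ := hf
          exact ⟨1, fun _ => a, fun _ => b, by simp⟩
        | zero => exact ⟨0, fun _ => 0, fun _ => 0, by simp⟩
        | add f g _ _ h1 h2 =>
          obtain ⟨r, a, b, rfl⟩ := h1
          obtain ⟨r', a', b', rfl⟩ := h2
          exact ⟨r + r', Fin.append a a', Fin.append b b', by simp [Fin.sum_univ_add]⟩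
        | neg f _ h =>
          obtain ⟨r, a, b, rfl⟩ := h
          exact ⟨r, fun j => -a j, b, by simp⟩
      obtain ⟨r, a, b, rfl⟩ := this
      exact ⟨r, biproduct.lift a, biproduct.desc b, by simp [biproduct.lift_desc]⟩
    obtain ⟨r, a, b, hab⟩ := key _ h
    exact ⟨r, ⟨⟨a, b, hab⟩⟩⟩

theorem InAdd.mem_through (h : InAdd M X) (f : X ⟶ Y) : f ∈ through M X Y := by
  simpa using through_comp (inAdd_iff_mem_through.1 h) f

theorem InAdd.mem_through' (h : InAdd M Y) (f : X ⟶ Y) : f ∈ through M X Y := by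
  simpa using comp_through (inAdd_iff_mem_through.1 h) f

theorem InAdd.through_le (h : InAdd M N) : through N X Y ≤ through M X Y := by
  refine (AddSubgroup.closure_le _).2 ?_
  rintro _ ⟨a, b, rfl⟩
  exact comp_through (h.mem_through b) a

theorem InAdd.refl (M : C) : InAdd M M := inAdd_iff_mem_through.2 (mem_through_self _)

theorem InAdd.trans (h : InAdd M N) (h' : InAdd N X) : InAdd M X :=
  inAdd_iff_mem_through.2 (h.through_le (inAdd_iff_mem_through.1 h'))

theorem InAdd.of_comp (i : X ⟶ Y) (p : Y ⟶ X) (h : i ≫ p = 𝟙 X) (hY : InAdd M Y) : InAdd M X :=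
  inAdd_iff_mem_through.2 (h ▸ through_comp (hY.mem_through' i) p)

theorem InAdd.of_iso (e : X ≅ Y) (hY : InAdd M Y) : InAdd M X :=
  hY.of_comp e.hom e.inv e.hom_inv_id

theorem InAdd.of_iso_left (e : M ≅ N) (h : InAdd M X) : InAdd N X :=
  ((InAdd.refl N).of_iso e).trans h

theorem InAdd.biprod [HasBinaryBiproducts C] (hX : InAdd M X) (hY : InAdd M Y) :
    InAdd M (X ⊞ Y) := by
  rw [inAdd_iff_mem_through, ← biprod.total]
  exact add_mem (comp_through (hX.mem_through _) _) (comp_through (hY.mem_through _) _)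

theorem InAdd.of_isZero (hX : IsZero X) : InAdd M X :=
  inAdd_iff_mem_through.2 (by rw [hX.eq_of_src (𝟙 X) 0]; exact zero_mem _)

theorem InAdd.map {D : Type*} [Category* D] [Preadditive D] [HasFiniteBiproducts D] (F : C ⥤ D)
    [F.Additive] (h : InAdd M X) : InAdd (F.obj M) (F.obj X) := by
  rw [inAdd_iff_mem_through, ← F.map_id]
  exact map_mem_through F (inAdd_iff_mem_through.1 h)

theorem inAdd_map_iff {D : Type*} [Category* D] [Preadditive D] [HasFiniteBiproducts D]
    (F : C ⥤ D) [F.Additive] [F.Full] [F.Faithful] :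
    InAdd (F.obj M) (F.obj X) ↔ InAdd M X := by
  refine ⟨fun h => ?_, fun h => h.map F⟩
  rw [inAdd_iff_mem_through, ← F.map_id] at h
  exact inAdd_iff_mem_through.2 (mem_through_of_map F h)

theorem exists_iso_map_of_inAdd {D : Type*} [Category* D] [Preadditive D] [HasFiniteBiproducts D]
    (F : C ⥤ D) [F.Additive] [F.IsEquivalence] {Y : D} (h : InAdd (F.obj M) Y) :
    ∃ X : C, InAdd M X ∧ Nonempty (Y ≅ F.obj X) := by
  have e := F.objObjPreimageIso Y
  exact ⟨_, (inAdd_map_iff F).1 (h.of_iso e), ⟨e.symm⟩⟩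

theorem factorZero_iff [HasBinaryBiproducts C] {S : C ⥤ C} {T : C} :
    FactorZero S T X Y ↔ ∀ (f : X ⟶ S.obj T) (g : S.obj T ⟶ Y), f ≫ g = 0 := by
  refine ⟨fun h f g => h _ (InAdd.refl _) f g, fun h Z hZ f g => ?_⟩
  simpa using comp_comp_eq_zero_of_mem_through (inAdd_iff_mem_through.1 hZ) f g h

theorem FactorZero.of_comp_left [HasBinaryBiproducts C] {S : C ⥤ C} {T : C}
    (h : FactorZero S T X Y) (i : Z ⟶ X) (p : X ⟶ Z) (hip : i ≫ p = 𝟙 Z) : FactorZero S T Z Y :=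
  fun W hW f g => by
    have := h W hW (p ≫ f) g
    rw [← Category.id_comp f, ← hip]
    simp only [Category.assoc] at this ⊢
    rw [this, comp_zero]

theorem FactorZero.of_comp_right [HasBinaryBiproducts C] {S : C ⥤ C} {T : C}
    (h : FactorZero S T X Y) (i : Z ⟶ Y) (p : Y ⟶ Z) (hip : i ≫ p = 𝟙 Z) : FactorZero S T X Z :=
  fun W hW f g => by
    have := h W hW f (g ≫ i)
    rw [← Category.comp_id g, ← hip, ← Category.assoc, ← Category.assoc, Category.assoc f, this,
      zero_comp]

theorem factorZero_congr [HasBinaryBiproducts C] {S : C ⥤ C} {T X' Y' : C} (e : X ≅ X')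
    (e' : Y ≅ Y') : FactorZero S T X Y ↔ FactorZero S T X' Y' :=
  ⟨fun h => (h.of_comp_left e.inv e.hom e.inv_hom_id).of_comp_right e'.inv e'.hom e'.inv_hom_id,
    fun h => (h.of_comp_left e.hom e.inv e.hom_inv_id).of_comp_right e'.hom e'.inv e'.hom_inv_id⟩

theorem factorZero_biprod_left [HasBinaryBiproducts C] {S : C ⥤ C} {T : C} :
    FactorZero S T (X ⊞ Z) Y ↔ FactorZero S T X Y ∧ FactorZero S T Z Y := by
  refine ⟨fun h => ⟨h.of_comp_left biprod.inl biprod.fst (by simp),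
    h.of_comp_left biprod.inr biprod.snd (by simp)⟩, fun ⟨h1, h2⟩ W hW f g => ?_⟩
  ext
  · simpa using h1 W hW (biprod.inl ≫ f) g
  · simpa using h2 W hW (biprod.inr ≫ f) g

theorem factorZero_biprod_right [HasBinaryBiproducts C] {S : C ⥤ C} {T : C} :
    FactorZero S T X (Y ⊞ Z) ↔ FactorZero S T X Y ∧ FactorZero S T X Z := by
  refine ⟨fun h => ⟨h.of_comp_right biprod.inl biprod.fst (by simp),
    h.of_comp_right biprod.inr biprod.snd (by simp)⟩, fun ⟨h1, h2⟩ W hW f g => ?_⟩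
  ext
  · simpa using h1 W hW f (g ≫ biprod.fst)
  · simpa using h2 W hW f (g ≫ biprod.snd)

end Through

/-! ### Nilpotency, cancellation and decompositions in Hom-finite categories. -/

section HomFinite

variable (k : Type w) [Field k]

/-- Fitting's argument in the commutative Artinian ring `k[x]`: from `xⁿ = xⁿ⁺¹y` it follows that
`xⁿ⁺¹yⁿ⁺¹` is an idempotent multiple of `x` fixing `xⁿ⁺¹`. If it vanishes, so does `xⁿ⁺¹`. -/
theorem isNilpotent_of_idempotent {E : Type*} [Ring E] [Algebra k E] [Module.Finite k E] (x : E)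
    (h : ∀ y, IsIdempotentElem (x * y) → x * y = 0) : IsNilpotent x := by
  let R := Algebra.adjoin k ({x} : Set E)
  have : IsMulCommutative R := inferInstance
  have : IsArtinianRing R := IsArtinianRing.of_finite k R
  let t : R := ⟨x, Algebra.self_mem_adjoin_singleton k x⟩
  obtain ⟨n, y, hy⟩ := IsArtinian.exists_pow_succ_smul_dvd t (1 : R)
  have hy' : t ^ (n + 1) * y = t ^ n := by simpa using hy
  have hm : ∀ m, t ^ n * (t * y) ^ m = t ^ n := by
    intro m
    induction m with
    | zero => simp
    | succ m ih => rw [pow_succ, ← mul_assoc, ih, ← mul_assoc, ← pow_succ, hy']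
  have hn : t ^ (n + 1) * (t ^ (n + 1) * y ^ (n + 1)) = t ^ (n + 1) := by
    rw [← mul_pow, pow_succ, mul_right_comm, hm]
  have he : (t * (t ^ n * y ^ (n + 1))) * (t * (t ^ n * y ^ (n + 1))) =
      t * (t ^ n * y ^ (n + 1)) := by
    have e : t * (t ^ n * y ^ (n + 1)) = t ^ (n + 1) * y ^ (n + 1) := by ring
    rw [e]
    calc t ^ (n + 1) * y ^ (n + 1) * (t ^ (n + 1) * y ^ (n + 1))
        = t ^ (n + 1) * (t ^ (n + 1) * y ^ (n + 1)) * y ^ (n + 1) := by ring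
      _ = t ^ (n + 1) * y ^ (n + 1) := by rw [hn]
  have h0 := h ((t ^ n * y ^ (n + 1) : R) : E) (congrArg Subtype.val he)
  refine ⟨n + 1, ?_⟩
  have h0' : t * (t ^ n * y ^ (n + 1)) = 0 := Subtype.ext h0
  have : t ^ (n + 1) = 0 := by
    rw [← hn]
    have e : t ^ (n + 1) * y ^ (n + 1) = t * (t ^ n * y ^ (n + 1)) := by ring
    rw [e, h0', mul_zero]
  exact congrArg Subtype.val this

variable {C : Type u} [Category.{v} C] [Preadditive C] [Linear k C]
  [IsIdempotentComplete C] [∀ X Y : C, Module.Finite k (X ⟶ Y)]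

include k

theorem isNilpotent_of_retract {X : C} (x : X ⟶ X)
    (h : ∀ (Z : C) (i : Z ⟶ X) (p : X ⟶ Z), i ≫ p = 𝟙 Z → (∃ y, p ≫ i = y ≫ x) → IsZero Z) :
    IsNilpotent (End.of x) := by
  refine isNilpotent_of_idempotent k (End.of x) fun y hy => ?_
  obtain ⟨Z, i, p, hip, hpi⟩ := IsIdempotentComplete.idempotents_split X (y ≫ x) hy
  have hZ := h Z i p hip ⟨y, hpi⟩
  change y ≫ x = 0
  rw [← hpi, hZ.eq_of_tgt p 0, zero_comp]

omit [IsIdempotentComplete C] [∀ X Y : C, Module.Finite k (X ⟶ Y)] [Linear k C] in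
omit k [Field k] in
theorem isIso_add_of_isNilpotent {X : C} {x y : X ⟶ X} (hx : IsNilpotent (End.of x))
    (h : x + y = 𝟙 X) : IsIso y := by
  rw [← isUnit_iff_isIso]
  have : y = (1 : End X) - End.of x := by
    change y = 𝟙 X - x
    rw [← h]; abel
  rw [this]
  exact hx.isUnit_one_sub

-- The two inclusions compose to a one-sided invertible element of the finite-dimensional algebra
-- `End B`, hence to a unit.
omit [IsIdempotentComplete C] in
theorem nonempty_iso_of_retracts {A B : C} (h : Retract A B) (h' : Retract B A) :
    Nonempty (A ≅ B) := by
  have : IsArtinianRing (End B) := IsArtinianRing.of_finite k (End B)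
  have h1 : (h'.i ≫ h.i) ≫ (h.r ≫ h'.r) = 𝟙 B := by simp
  have h2 : (h.r ≫ h'.r) ≫ (h'.i ≫ h.i) = 𝟙 B :=
    mul_eq_one_symm (M := End B) (a := h.r ≫ h'.r) (b := h'.i ≫ h.i) h1
  have h3 : h.r ≫ h.i = 𝟙 B := by
    calc h.r ≫ h.i = (h.r ≫ h.i) ≫ ((h.r ≫ h'.r) ≫ (h'.i ≫ h.i)) := by rw [h2, Category.comp_id]
      _ = 𝟙 B := by rw [← h2]; simp
  exact ⟨⟨h.i, h.r, h.retract, h3⟩⟩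

/-- No nonzero object lies in both `add M` and `add N`. -/
def AddDisjoint [HasFiniteBiproducts C] (M N : C) : Prop :=
  ∀ X : C, InAdd M X → InAdd N X → IsZero X

section AddDisjoint

variable [HasFiniteBiproducts C] {M N : C}

/-- A retract whose idempotent is a multiple of `x` has its identity in both ideals, so it lies in
both additive closures and is zero. -/
theorem AddDisjoint.isNilpotent (hd : AddDisjoint M N) {X : C} {x : X ⟶ X}
    (hM : x ∈ through M X X) (hN : x ∈ through N X X) : IsNilpotent (End.of x) := by
  refine isNilpotent_of_retract k x fun Z i p hip ⟨y, hy⟩ => ?_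
  have e : 𝟙 Z = (i ≫ y) ≫ x ≫ p := by
    rw [Category.assoc, ← Category.assoc y, ← hy, Category.assoc, hip, Category.comp_id, hip]
  refine hd Z ?_ ?_ <;> rw [inAdd_iff_mem_through, e]
  · exact comp_through (through_comp hM _) _
  · exact comp_through (through_comp hN _) _

/-- Passes from summands of `M` to summands of powers of `M`. Every composite `X ⟶ M ⟶ X` is
nilpotent, so subtracting one from a unit leaves a unit. As the identity is a sum of such
composites, `0 = 1 - 1` is a unit of `End X`. -/
theorem addDisjoint_of_retract
    (h : ∀ X : C, Nonempty (Retract X M) → InAdd N X → IsZero X) : AddDisjoint M N := by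
  intro X hM hN
  have hnil : ∀ (f : X ⟶ M) (g : M ⟶ X), IsNilpotent (End.of (f ≫ g)) := by
    intro f g
    refine isNilpotent_of_retract k _ fun Z i p hip ⟨y, hy⟩ => ?_
    refine h Z ⟨⟨i ≫ y ≫ f, g ≫ p, ?_⟩⟩ (hN.of_comp i p hip)
    have e : i ≫ (y ≫ f ≫ g) ≫ p = 𝟙 Z := by
      rw [← hy, Category.assoc, hip, Category.comp_id, hip]
    simpa using e
  -- An arbitrary unit `u` is needed in place of `1`: a sum of nilpotents need not be nilpotent, so
  -- the composites are removed one after another.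
  have key : ∀ x ∈ through M X X, ∀ u : End X, IsUnit u → IsUnit (u - End.of x) := by
    intro x hx
    induction hx using AddSubgroup.closure_induction with
    | mem x hx =>
      obtain ⟨a, b, rfl⟩ := hx
      rintro _ ⟨u, rfl⟩
      have hu : IsNilpotent ((↑u⁻¹ : End X) * End.of (a ≫ b)) := by
        have := hnil a (b ≫ (↑u⁻¹ : End X))
        rwa [← Category.assoc] at this
      have e : (u : End X) - End.of (a ≫ b) = u * (1 - (↑u⁻¹ : End X) * End.of (a ≫ b)) := by
        rw [mul_sub, Units.mul_inv_cancel_left, mul_one]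
      rw [e]
      exact u.isUnit.mul hu.isUnit_one_sub
    | zero =>
      intro u hu
      exact (sub_zero u).symm ▸ hu
    | add x y _ _ h1 h2 =>
      intro u hu
      have := h2 _ (h1 u hu)
      rwa [sub_sub] at this
    | neg x _ h1 =>
      intro u hu
      have := (h1 _ hu.neg).neg
      rw [neg_sub, sub_neg_eq_add, add_comm] at this
      have e : u - End.of (-x) = u + End.of x := sub_neg_eq_add u (End.of x)
      rwa [e]
  have h0 := key _ (inAdd_iff_mem_through.1 hM) 1 isUnit_one
  have e : (1 : End X) - End.of (𝟙 X) = 0 := sub_self _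
  rw [e, isUnit_zero_iff] at h0
  exact (IsZero.iff_id_eq_zero X).2 h0.symm

omit [IsIdempotentComplete C] [∀ X Y : C, Module.Finite k (X ⟶ Y)] [Linear k C] in
omit k [Field k] in
theorem AddDisjoint.of_inAdd (hd : AddDisjoint M N) {M' : C} (h : InAdd M M') :
    AddDisjoint M' N := fun X hM hN => hd X (h.trans hM) hN

/-- An exchange property: `x` is nilpotent, so `y = 1 - x` is invertible and the identity of `X`
passes through `M'` alone. -/
theorem AddDisjoint.inAdd_of_mem_through (hd : AddDisjoint M N) {X M' : C} (hN : InAdd N X)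
    {x y : X ⟶ X} (hx : x ∈ through M X X) (hy : y ∈ through M' X X) (h : x + y = 𝟙 X) :
    InAdd M' X := by
  have hi := isIso_add_of_isNilpotent (hd.isNilpotent k hx (hN.mem_through x)) h
  rw [inAdd_iff_mem_through, ← IsIso.inv_hom_id y]
  exact comp_through hy _

theorem AddDisjoint.biprod [HasBinaryBiproducts C] {M' : C} (hd : AddDisjoint M N)
    (hd' : AddDisjoint M' N) : AddDisjoint (M ⊞ M') N := by
  intro X hM hN
  obtain ⟨x, hx, y, hy, e⟩ := exists_add_of_mem_through_biprod (inAdd_iff_mem_through.1 hM)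
  exact hd' X (hd.inAdd_of_mem_through k hN hx hy e.symm) hN

end AddDisjoint

section Decomposition

variable [HasFiniteBiproducts C] [HasBinaryBiproducts C] {S : C ⥤ C} {T M M₀ TM : C}

theorem IsDecomposition.addDisjoint (h : IsDecomposition S T M M₀ TM) :
    AddDisjoint M₀ (S.obj T) := addDisjoint_of_retract k h.maximal

omit [∀ X Y : C, Module.Finite k (X ⟶ Y)] [Linear k C] [HasFiniteBiproducts C] in
omit k [Field k] in
theorem exists_complement {X M : C} (h : Retract X M) : ∃ M' : C, Nonempty (M ≅ M' ⊞ X) := by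
  obtain ⟨Y, i, p, hip, hpi⟩ := IsIdempotentComplete.idempotents_split M (𝟙 M - h.r ≫ h.i)
    (by simp [Preadditive.sub_comp, Preadditive.comp_sub])
  have h1 : i ≫ h.r = 0 := by
    have : i ≫ (p ≫ i) ≫ h.r = 0 := by rw [hpi]; simp [Preadditive.sub_comp]
    simpa [reassoc_of% hip] using this
  have h2 : h.i ≫ p = 0 := by
    have : h.i ≫ (p ≫ i) ≫ p = 0 := by rw [hpi]; simp [Preadditive.sub_comp, Preadditive.comp_sub]
    simpa [hip] using this
  refine ⟨Y, ⟨⟨biprod.lift p h.r, biprod.desc i h.i, ?_, ?_⟩⟩⟩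
  · rw [biprod.lift_desc, hpi]; abel
  · ext <;> simp [hip, h1, h2]

-- `End M'` is a corner of `End M`, and the idempotent of `X` is killed by the projection. This is
-- the measure that makes splitting off summands terminate.
omit [IsIdempotentComplete C] [HasFiniteBiproducts C] in
theorem finrank_end_lt {M M' X : C} (e : M ≅ M' ⊞ X) (hX : ¬ IsZero X) :
    Module.finrank k (M' ⟶ M') < Module.finrank k (M ⟶ M) := by
  let φ : (M ⟶ M) →ₗ[k] (M' ⟶ M') :=
    { toFun := fun f => (biprod.inl ≫ e.inv) ≫ f ≫ (e.hom ≫ biprod.fst)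
      map_add' := by intros; simp
      map_smul' := by intros; simp }
  have hs : Function.Surjective φ := fun f =>
    ⟨e.hom ≫ biprod.fst ≫ f ≫ biprod.inl ≫ e.inv, by simp [φ]⟩
  have hk : LinearMap.ker φ ≠ ⊥ := by
    intro h
    apply hX
    have h0 : e.hom ≫ biprod.snd ≫ biprod.inr ≫ e.inv ∈ LinearMap.ker φ := by
      simp [φ]
    rw [h, Submodule.mem_bot] at h0
    rw [IsZero.iff_id_eq_zero]
    have : biprod.inr ≫ e.inv ≫ (e.hom ≫ biprod.snd ≫ biprod.inr ≫ e.inv) ≫ e.hom ≫ biprod.snd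
        = 𝟙 X := by simp
    rw [← this, h0]; simp
  have h1 := LinearMap.finrank_range_add_finrank_ker φ
  rw [LinearMap.range_eq_top.2 hs, finrank_top] at h1
  have h2 : 0 < Module.finrank k (LinearMap.ker φ) :=
    Module.finrank_pos_iff.2 (Submodule.nontrivial_iff_ne_bot.2 hk)
  omega

theorem exists_isDecomposition [HasZeroObject C] [S.IsEquivalence] [S.Additive] (T M : C) :
    ∃ M₀ TM, IsDecomposition S T M M₀ TM := by
  induction hn : Module.finrank k (M ⟶ M) using Nat.strong_induction_on generalizing M with
  | _ n ih =>
    by_cases h : ∀ X : C, Nonempty (Retract X M) → InAdd (S.obj T) X → IsZero X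
    · have hz : IsZero (S.obj (0 : C)) := S.map_isZero (isZero_zero C)
      refine ⟨M, 0, ⟨⟨⟨biprod.inl, biprod.fst, by simp, ?_⟩⟩, .of_isZero (isZero_zero C), h⟩⟩
      ext
      · simp
      · simp
      · exact hz.eq_of_src _ _
      · exact hz.eq_of_src _ _
    · push Not at h
      obtain ⟨X, ⟨r⟩, hX, hX0⟩ := h
      obtain ⟨M', ⟨e⟩⟩ := exists_complement r
      obtain ⟨M₀, TM, ⟨e'⟩, hTM, hmax⟩ := ih _ (hn ▸ finrank_end_lt k e hX0) M' rfl
      obtain ⟨Y, hY, ⟨e''⟩⟩ := exists_iso_map_of_inAdd S hX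
      have := preservesBinaryBiproducts_of_preservesBiproducts S
      refine ⟨M₀, TM ⊞ Y, ⟨⟨?_⟩, hTM.biprod hY, hmax⟩⟩
      exact e ≪≫ biprod.mapIso e' e'' ≪≫ biprod.associator _ _ _ ≪≫
        biprod.mapIso (Iso.refl _) (S.mapBiprod TM Y).symm

end Decomposition

end HomFinite

end Angulated

/-! ### The functor `C(T, -)` on `add T` and projective modules. -/

namespace TauTilting

open Angulated

section PostComp

variable (k : Type w) [Field k] {C : Type u} [Category.{v} C] [Preadditive C] [Linear k C]
  [∀ X Y : C, Module.Finite k (X ⟶ Y)] (T : C)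

/-- Composition with `f`, as a linear map `C(T, X) → C(T, Y)`. -/
def postcomp {X Y : C} (f : X ⟶ Y) :
    (homFunctor k T).obj X →ₗ[(End T)ᵐᵒᵖ] (homFunctor k T).obj Y :=
  ((homFunctor k T).map f).hom.hom

variable {T} {X Y Z : C}

/-- A morphism `T ⟶ X` as an element of the module `C(T, X)`. -/
def toHom (x : T ⟶ X) : (homFunctor k T).obj X := x

variable {k} in
/-- An element of the module `C(T, X)` as a morphism `T ⟶ X`. -/
def ofHom (x : (homFunctor k T).obj X) : T ⟶ X := x

theorem toHom_comp (f : X ⟶ Y) (x : T ⟶ X) : toHom k (x ≫ f) = postcomp k T f (toHom k x) := rfl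

theorem toHom_smul (a : T ⟶ T) (x : T ⟶ X) :
    toHom k (a ≫ x) = MulOpposite.op (End.of a) • toHom k x := rfl

theorem toHom_add (x y : T ⟶ X) : toHom k (x + y) = toHom k x + toHom k y := rfl

theorem toHom_zero : toHom k (0 : T ⟶ X) = 0 := rfl

theorem postcomp_ext_iff {f : X ⟶ Y} {φ : (homFunctor k T).obj X →ₗ[(End T)ᵐᵒᵖ]
    (homFunctor k T).obj Y} : postcomp k T f = φ ↔ ∀ x : T ⟶ X, toHom k (x ≫ f) = φ (toHom k x) :=
  LinearMap.ext_iff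

theorem postcomp_id (X : C) : postcomp k T (𝟙 X) = LinearMap.id :=
  (postcomp_ext_iff k).2 fun x => by rw [Category.comp_id]; rfl

theorem postcomp_comp (f : X ⟶ Y) (g : Y ⟶ Z) :
    postcomp k T (f ≫ g) = postcomp k T g ∘ₗ postcomp k T f :=
  (postcomp_ext_iff k).2 fun x => by rw [← Category.assoc]; rfl

theorem postcomp_add (f g : X ⟶ Y) : postcomp k T (f + g) = postcomp k T f + postcomp k T g :=
  (postcomp_ext_iff k).2 fun x => by rw [Preadditive.comp_add]; rfl

theorem postcomp_neg (f : X ⟶ Y) : postcomp k T (-f) = -postcomp k T f :=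
  (postcomp_ext_iff k).2 fun x => by rw [Preadditive.comp_neg]; rfl

theorem postcomp_zero : postcomp k T (0 : X ⟶ Y) = 0 :=
  (postcomp_ext_iff k).2 fun x => by rw [comp_zero]; rfl

theorem postcomp_sub (f g : X ⟶ Y) : postcomp k T (f - g) = postcomp k T f - postcomp k T g :=
  (postcomp_ext_iff k).2 fun x => by rw [Preadditive.comp_sub]; rfl

/-- The isomorphism `C(T, X) ≃ C(T, Y)` induced by an isomorphism `X ≅ Y`. -/
def postcompEquiv (e : X ≅ Y) :
    (homFunctor k T).obj X ≃ₗ[(End T)ᵐᵒᵖ] (homFunctor k T).obj Y :=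
  LinearEquiv.ofLinearMap (postcomp k T e.hom) (postcomp k T e.inv)
    (by rw [← postcomp_comp, e.inv_hom_id, postcomp_id])
    (by rw [← postcomp_comp, e.hom_inv_id, postcomp_id])

theorem comp_eq_zero_of_postcomp {f : X ⟶ Y} (h : postcomp k T f = 0) (x : T ⟶ X) : x ≫ f = 0 :=
  (postcomp_ext_iff k).1 h x

variable [HasFiniteBiproducts C]

theorem postcomp_injective (hX : InAdd T X) {f g : X ⟶ Y} (h : postcomp k T f = postcomp k T g) :
    f = g := by
  rw [← sub_eq_zero]
  have h' : postcomp k T (f - g) = 0 := by rw [postcomp_sub, h, sub_self]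
  have key : ∀ t ∈ through T X X, t ≫ (f - g) = 0 := by
    intro t ht
    induction ht using AddSubgroup.closure_induction with
    | mem t ht =>
      obtain ⟨a, b, rfl⟩ := ht
      rw [Category.assoc, comp_eq_zero_of_postcomp k h', comp_zero]
    | zero => simp
    | add s t _ _ h1 h2 => rw [Preadditive.add_comp, h1, h2, add_zero]
    | neg s _ h1 => rw [Preadditive.neg_comp, h1, neg_zero]
  simpa using key _ (inAdd_iff_mem_through.1 hX)

/-- The Yoneda lemma extended to `add T`: for a composite `a ≫ b` through `T`, the map `φ ∘ C(T, a ≫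
b)` is induced by `a ≫ φ(b)`, and the identity of `X` is a sum of such composites. -/
theorem exists_postcomp_eq (hX : InAdd T X) (φ : (homFunctor k T).obj X →ₗ[(End T)ᵐᵒᵖ]
    (homFunctor k T).obj Y) : ∃ f : X ⟶ Y, postcomp k T f = φ := by
  have key : ∀ t ∈ through T X X, ∃ f : X ⟶ Y, ∀ x : T ⟶ X,
      toHom k (x ≫ f) = φ (toHom k (x ≫ t)) := by
    intro t ht
    induction ht using AddSubgroup.closure_induction with
    | mem t ht =>
      obtain ⟨a, b, rfl⟩ := ht
      refine ⟨a ≫ ofHom (φ (toHom k b)), fun x => ?_⟩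
      rw [← Category.assoc, ← Category.assoc, toHom_smul, toHom_smul, map_smul]
      rfl
    | zero => exact ⟨0, fun x => by rw [comp_zero, comp_zero, toHom_zero, toHom_zero, map_zero]⟩
    | add s t _ _ h1 h2 =>
      obtain ⟨f, hf⟩ := h1
      obtain ⟨g, hg⟩ := h2
      refine ⟨f + g, fun x => ?_⟩
      rw [Preadditive.comp_add, Preadditive.comp_add, toHom_add, toHom_add, hf, hg, map_add]
    | neg s _ h1 =>
      obtain ⟨f, hf⟩ := h1
      refine ⟨-f, fun x => ?_⟩
      rw [Preadditive.comp_neg, Preadditive.comp_neg]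
      change -toHom k (x ≫ f) = φ (-toHom k (x ≫ s))
      rw [hf, map_neg]
  obtain ⟨f, hf⟩ := key _ (inAdd_iff_mem_through.1 hX)
  exact ⟨f, (postcomp_ext_iff k).2 fun x => by rw [hf, Category.comp_id]⟩

theorem projective_of_inAdd (hX : InAdd T X) :
    Module.Projective (End T)ᵐᵒᵖ ((homFunctor k T).obj X) := by
  obtain ⟨r, ⟨ρ⟩⟩ := hX
  let i : (homFunctor k T).obj X →ₗ[(End T)ᵐᵒᵖ] (Fin r → (End T)ᵐᵒᵖ) :=
    { toFun := fun x j => MulOpposite.op (End.of (ofHom x ≫ ρ.i ≫ biproduct.π _ j))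
      map_add' := fun x y => funext fun j => congrArg MulOpposite.op
        (Preadditive.add_comp _ _ _ (ofHom x) (ofHom y) _)
      map_smul' := fun a x => funext fun j => congrArg MulOpposite.op
        (Category.assoc (a.unop : T ⟶ T) (ofHom x) _) }
  let p : (Fin r → (End T)ᵐᵒᵖ) →ₗ[(End T)ᵐᵒᵖ] (homFunctor k T).obj X :=
    { toFun := fun c => toHom k (biproduct.lift (fun j => ((c j).unop : T ⟶ T)) ≫ ρ.r)
      map_add' := fun c d => by
        rw [← toHom_add, ← Preadditive.add_comp]
        congr 2
        ext j
        simp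
      map_smul' := fun a c => by
        refine Eq.trans ?_ (toHom_smul k (a.unop : T ⟶ T) _)
        rw [← Category.assoc]
        congr 2
        ext j
        simp }
  refine Module.Projective.of_split i p (LinearMap.ext fun x => ?_)
  have : biproduct.lift (fun j : Fin r => ofHom x ≫ ρ.i ≫ biproduct.π (fun _ : Fin r => T) j) ≫ ρ.r
      = ofHom x := by
    have : biproduct.lift (fun j : Fin r => ofHom x ≫ ρ.i ≫ biproduct.π (fun _ : Fin r => T) j) =
        ofHom x ≫ ρ.i := by ext j; simp
    rw [this]; simp
  exact this

/-- `P` is the image of an idempotent `ι ∘ π` on a free module `C(T, Tʳ)`. That idempotent comes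
from one of `Tʳ`, which splits in `C`. -/
theorem exists_iso_of_projective [IsIdempotentComplete C] (P : FGModuleCat.{v} (End T)ᵐᵒᵖ)
    (hP : Module.Projective (End T)ᵐᵒᵖ P) :
    ∃ X : C, InAdd T X ∧ Nonempty ((homFunctor k T).obj X ≃ₗ[(End T)ᵐᵒᵖ] P) := by
  obtain ⟨r, π, hπ⟩ := Module.Finite.exists_fin' (End T)ᵐᵒᵖ P
  obtain ⟨ι, hι⟩ := Module.projective_lifting_property π LinearMap.id hπ
  let B : C := ⨁ fun _ : Fin r => T
  have hB : InAdd T B := ⟨r, ⟨Retract.refl _⟩⟩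
  let θ : (homFunctor k T).obj B ≃ₗ[(End T)ᵐᵒᵖ] (Fin r → (End T)ᵐᵒᵖ) :=
    { toFun := fun x j => MulOpposite.op (End.of (ofHom x ≫ biproduct.π _ j))
      map_add' := fun x y => funext fun j => congrArg MulOpposite.op
        (Preadditive.add_comp _ _ _ (ofHom x) (ofHom y) _)
      map_smul' := fun a x => funext fun j => congrArg MulOpposite.op
        (Category.assoc (a.unop : T ⟶ T) (ofHom x) _)
      invFun := fun c => toHom k (biproduct.lift (fun j => ((c j).unop : T ⟶ T)))
      left_inv := fun x => by
        have : biproduct.lift (fun j : Fin r => ofHom x ≫ biproduct.π (fun _ : Fin r => T) j)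
            = ofHom x := by ext j; simp
        exact this
      right_inv := fun c => funext fun j => congrArg MulOpposite.op (by
        change biproduct.lift (fun j => ((c j).unop : T ⟶ T)) ≫ biproduct.π _ j = (c j).unop
        simp) }
  obtain ⟨f, hf⟩ := exists_postcomp_eq k hB (θ.symm.toLinearMap ∘ₗ ι ∘ₗ π ∘ₗ θ.toLinearMap)
  have hι' : ∀ x, π (ι x) = x := LinearMap.congr_fun hι
  have hf' : ∀ x, postcomp k T f x = θ.symm (ι (π (θ x))) := LinearMap.congr_fun hf
  obtain ⟨Y, i, p, hip, hpi⟩ := IsIdempotentComplete.idempotents_split B f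
    (postcomp_injective k hB (by
      rw [postcomp_comp]
      ext x
      simp [hf', hι']))
  have hip' : ∀ x, postcomp k T p (postcomp k T i x) = x := fun x => by
    have := postcomp_comp k (T := T) i p
    rw [hip, postcomp_id] at this
    exact (LinearMap.congr_fun this x).symm
  have hpi' : ∀ x, postcomp k T i (postcomp k T p x) = postcomp k T f x := fun x => by
    have := postcomp_comp k (T := T) p i
    rw [hpi] at this
    exact (LinearMap.congr_fun this x).symm
  refine ⟨Y, hB.of_comp i p hip, ⟨LinearEquiv.ofLinearMap (π ∘ₗ θ.toLinearMap ∘ₗ postcomp k T i)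
    (postcomp k T p ∘ₗ θ.symm.toLinearMap ∘ₗ ι) ?_ ?_⟩⟩
  · ext x
    simp [hpi', hf', hι']
  · ext x
    have h1 : postcomp k T p (θ.symm (ι (π (θ (postcomp k T i x))))) = x := by
      rw [← hf', ← hpi', hip', hip']
    exact h1

end PostComp

end TauTilting

/-! ### Fullness and kernel of `C(T, -)` for cluster tilting `T`. -/

namespace TauTilting

open Angulated Angulated.Seq

section ClusterTilting

variable {C : Type u} [Category.{v} C] [Preadditive C]
  [HasZeroObject C] [HasBinaryBiproducts C] [HasFiniteBiproducts C]
  {S : C ⥤ C} [S.Additive] {T : C}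

omit [HasZeroObject C] [HasBinaryBiproducts C] in
theorem hom_eq_zero_of_inAdd (hT : ∀ f : T ⟶ S.obj T, f = 0) {X Y : C} (hX : InAdd T X)
    (hY : InAdd T Y) (f : X ⟶ S.obj Y) : f = 0 := by
  have h := comp_comp_eq_zero_of_mem_through (inAdd_iff_mem_through.1 (hY.map S)) f (𝟙 _)
    fun a b => ?_
  · simpa using h
  · have h := comp_comp_eq_zero_of_mem_through (inAdd_iff_mem_through.1 hX) (𝟙 X) a
      fun a b => by rw [hT b, comp_zero]
    have ha : a = 0 := by simpa using h
    rw [ha, zero_comp]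

variable [S.Full] [S.Faithful] {m : ℕ} {𝒩 : Angulation S (m + 1)}

theorem exists_presentation (hT : IsClusterTilting 𝒩 T) (X : C) :
    ∃ (T₁ T₀ U : C) (d : T₁ ⟶ T₀) (p : T₀ ⟶ X) (δ : X ⟶ S.obj U),
      InAdd T T₁ ∧ InAdd T T₀ ∧ InAdd T U ∧ ExactPair d p ∧ ExactPair p δ := by
  obtain ⟨Z, hZ, hadd, ⟨e⟩⟩ := hT.exists_angle X
  refine ⟨_, _, _, Z.map (Fin.last m).castSucc, Z.map (Fin.last (m + 1)) ≫ e.hom, e.inv ≫ Z.last,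
    hadd _, hadd (Fin.last m).succ, hadd 0,
    (𝒩.exactPair (Fin.last m) hZ).comp_iso_right e, (𝒩.exactPair_last hZ).comp_iso e⟩

variable (k : Type w) [Field k] [Linear k C] [∀ X Y : C, Module.Finite k (X ⟶ Y)]
  (hT : IsClusterTilting 𝒩 T) {X Y M N : C}

include hT

/-- Such an `f` vanishes on `T₀`, so it factors through `X ⟶ ΣU`. -/
theorem mem_through_of_postcomp_eq_zero {f : X ⟶ Y} (hf : postcomp k T f = 0) :
    f ∈ through (S.obj T) X Y := by
  obtain ⟨T₁, T₀, U, d, p, δ, h1, h0, hU, -, hp⟩ := exists_presentation hT X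
  have h : p ≫ f = 0 := postcomp_injective k h0 (by
    rw [postcomp_comp, hf, LinearMap.zero_comp, postcomp_zero])
  obtain ⟨l, rfl⟩ := hp.desc f h
  exact through_comp ((hU.map S).mem_through' δ) l

omit [S.Additive] [S.Full] [S.Faithful] in
theorem postcomp_eq_zero_of_mem_through {f : X ⟶ Y} (hf : f ∈ through (S.obj T) X Y) :
    postcomp k T f = 0 :=
  (postcomp_ext_iff k).2 fun x => by
    have h := comp_comp_eq_zero_of_mem_through hf x (𝟙 Y) fun a b => by
      rw [hT.rigid a, zero_comp]
    rw [Category.comp_id] at h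
    rw [h]; rfl

theorem exists_lift (φ : (homFunctor k T).obj X →ₗ[(End T)ᵐᵒᵖ] (homFunctor k T).obj Y) :
    ∃ f : X ⟶ Y, postcomp k T f = φ := by
  obtain ⟨T₁, T₀, U, d, p, δ, h1, h0, hU, hd, hp⟩ := exists_presentation hT X
  obtain ⟨g, hg⟩ := exists_postcomp_eq k h0 (φ ∘ₗ postcomp k T p)
  -- `g` lifts `φ` to `T₀` and vanishes on `T₁`, so it descends to `X` by the weak cokernel
  -- property.
  obtain ⟨f, hf⟩ := hd.desc g (postcomp_injective k h1 (by
    rw [postcomp_comp, hg, LinearMap.comp_assoc, ← postcomp_comp, hd.zero, postcomp_zero,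
      postcomp_zero, LinearMap.comp_zero]))
  refine ⟨f, (postcomp_ext_iff k).2 fun x => ?_⟩
  obtain ⟨y, rfl⟩ := hp.lift x (hom_eq_zero_of_inAdd hT.rigid (.refl T) hU _)
  rw [Category.assoc, hf, toHom_comp, hg]
  rfl

variable [IsIdempotentComplete C]

theorem isIso_of_postcomp_eq_id (hX : AddDisjoint X (S.obj T)) {f : X ⟶ X}
    (hf : postcomp k T f = LinearMap.id) : IsIso f :=
  isIso_add_of_isNilpotent (x := 𝟙 X - f) (hX.isNilpotent k (mem_through_self _)
    (mem_through_of_postcomp_eq_zero k hT (by rw [postcomp_sub, postcomp_id, hf, sub_self])))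
    (by abel)

theorem nonempty_iso_of_homFunctor (hX : AddDisjoint X (S.obj T)) (hY : AddDisjoint Y (S.obj T))
    (e : (homFunctor k T).obj X ≃ₗ[(End T)ᵐᵒᵖ] (homFunctor k T).obj Y) : Nonempty (X ≅ Y) := by
  obtain ⟨f, hf⟩ := exists_lift k hT e.toLinearMap
  obtain ⟨g, hg⟩ := exists_lift k hT e.symm.toLinearMap
  have h1 : IsIso (f ≫ g) := isIso_of_postcomp_eq_id k hT hX (by
    rw [postcomp_comp, hf, hg]; ext x; simp)
  have h2 : IsIso (g ≫ f) := isIso_of_postcomp_eq_id k hT hY (by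
    rw [postcomp_comp, hf, hg]; ext x; simp)
  have hs : IsSplitMono f := ⟨⟨⟨g ≫ inv (f ≫ g), by rw [← Category.assoc, IsIso.hom_inv_id]⟩⟩⟩
  have he : Epi f := ⟨fun a b h => by
    rw [← cancel_epi (g ≫ f), Category.assoc, Category.assoc, h]⟩
  have := isIso_of_epi_of_isSplitMono f
  exact ⟨asIso f⟩

omit hT [IsIdempotentComplete C] [HasZeroObject C] [HasBinaryBiproducts C] in
theorem modInAdd_of_inAdd (h : InAdd M N) :
    ModInAdd ((homFunctor k T).obj M) ((homFunctor k T).obj N) :=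
  InAdd.map (preadditiveCoyonedaObj T) h

/-- By fullness the expression of the identity of `C(T, N)` as a sum of composites lifts to `C`. The
lifted endomorphism differs from `𝟙 N` by a nilpotent, so it is invertible. -/
theorem inAdd_of_modInAdd (hN : AddDisjoint N (S.obj T))
    (h : ModInAdd ((homFunctor k T).obj M) ((homFunctor k T).obj N)) : InAdd M N := by
  have key : ∀ t ∈ through ((homFunctor k T).obj M).obj ((homFunctor k T).obj N).obj
      ((homFunctor k T).obj N).obj, ∃ s ∈ through M N N, postcomp k T s = t.hom := by
    intro t ht
    induction ht using AddSubgroup.closure_induction with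
    | mem t ht =>
      obtain ⟨a, b, rfl⟩ := ht
      obtain ⟨f, hf⟩ := exists_lift k hT a.hom
      obtain ⟨g, hg⟩ := exists_lift k hT b.hom
      exact ⟨f ≫ g, comp_mem_through f g, by rw [postcomp_comp, hf, hg]; rfl⟩
    | zero => exact ⟨0, zero_mem _, postcomp_zero k⟩
    | add s t _ _ h1 h2 =>
      obtain ⟨f, hf, hf'⟩ := h1
      obtain ⟨g, hg, hg'⟩ := h2
      exact ⟨f + g, add_mem hf hg, by rw [postcomp_add, hf', hg']; rfl⟩
    | neg s _ h1 =>
      obtain ⟨f, hf, hf'⟩ := h1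
      exact ⟨-f, neg_mem hf, by rw [postcomp_neg, hf']; rfl⟩
  obtain ⟨s, hs, hs'⟩ := key _ (inAdd_iff_mem_through.1 h)
  have := isIso_of_postcomp_eq_id k hT hN hs'
  rw [inAdd_iff_mem_through, ← IsIso.inv_hom_id s]
  exact comp_through hs _

end ClusterTilting

end TauTilting

/-! ### Nakayama duality and stable comparison of projective presentations. -/

namespace TauTilting

section DualBasis

variable {A : Type v} [Ring A] {P : Type v} [AddCommGroup P] [Module A P]

theorem exists_dualBasis [Module.Finite A P] [Module.Projective A P] :
    ∃ (r : ℕ) (p : Fin r → P) (ξ : Fin r → (P →ₗ[A] A)), ∀ x, ∑ j, ξ j x • p j = x := by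
  obtain ⟨r, π, hπ⟩ := Module.Finite.exists_fin' A P
  obtain ⟨s, hs⟩ := Module.projective_lifting_property π LinearMap.id hπ
  refine ⟨r, fun j => π (Pi.single j 1), fun j => LinearMap.proj j ∘ₗ s, fun x => ?_⟩
  have h : π (s x) = x := LinearMap.congr_fun hs x
  conv_rhs => rw [← h, ← Finset.univ_sum_single (s x), map_sum]
  refine Finset.sum_congr rfl fun j _ => ?_
  rw [← map_smul, ← Pi.single_smul, smul_eq_mul, mul_one]
  rfl

/-- The morphism `x ↦ ξ(x) m`. -/
def rankOne {M : Type*} [AddCommGroup M] [Module A M] (ξ : P →ₗ[A] A) (m : M) : P →ₗ[A] M :=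
  LinearMap.toSpanSingleton A M m ∘ₗ ξ

@[simp]
theorem rankOne_apply {M : Type*} [AddCommGroup M] [Module A M] (ξ : P →ₗ[A] A) (m : M) (x : P) :
    rankOne ξ m x = ξ x • m := rfl

end DualBasis

section Nakayama

variable (k : Type w) [Field k] {A : Type v} [Ring A] [Algebra k A]
  {P Q M : Type v} [AddCommGroup P] [Module A P] [AddCommGroup Q] [Module A Q]
  [AddCommGroup M] [Module A M]

/-- The value of an element of `D Hom_A(P, A)` at a linear form. -/
def Nakayama.eval (φ : Nakayama k (A := A) P) : (P →ₗ[A] A) →ₗ[k] k := φ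

/-- An element of `D Hom_A(P, A)` given by a linear form on `Hom_A(P, A)`. -/
def Nakayama.mk (φ : (P →ₗ[A] A) →ₗ[k] k) : Nakayama k (A := A) P := φ

variable {k}

theorem Nakayama.ext {φ ψ : Nakayama k (A := A) P} (h : ∀ ξ, φ.eval k ξ = ψ.eval k ξ) : φ = ψ :=
  LinearMap.ext h

/-- The duality `Hom(M, D Hom(P, A)) ≅ D Hom(P, M)`, made explicit by rank-one maps: `f` becomes a
functional `Θ` with `Θ (rankOne ξ m) = f(m)(ξ)`. Landing in the kernel means that `Θ` kills every
map factoring through `δ`. -/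
theorem hom_ker_eq_zero_of_extend [Module.Finite A P] [Module.Projective A P] [Module.Finite A Q]
    [Module.Projective A Q] {δ : P →ₗ[A] Q} (h : ∀ g : P →ₗ[A] M, ∃ l : Q →ₗ[A] M, g = l ∘ₗ δ)
    (f : M →ₗ[A] LinearMap.ker (Nakayama.map k δ)) : f = 0 := by
  obtain ⟨r, p, η, hp⟩ := exists_dualBasis (A := A) (P := P)
  obtain ⟨s, q, ζ, hq⟩ := exists_dualBasis (A := A) (P := Q)
  let F : M → (P →ₗ[A] A) →ₗ[k] k := fun m => Nakayama.eval k (f m : Nakayama k (A := A) P)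
  have hFsmul : ∀ (a : A) (m : M) (ξ : P →ₗ[A] A), F (a • m) ξ = F m (MulOpposite.op a • ξ) := fun a m ξ => by
    change Nakayama.eval k (f (a • m) : Nakayama k (A := A) P) ξ = _
    rw [map_smul]
    rfl
  have hFadd : ∀ m m' ξ, F (m + m') ξ = F m ξ + F m' ξ := fun m m' ξ => by
    change Nakayama.eval k (f (m + m') : Nakayama k (A := A) P) ξ = _
    rw [map_add]
    rfl
  have hF0 : ∀ ξ, F 0 ξ = 0 := fun ξ => by
    change Nakayama.eval k (f 0 : Nakayama k (A := A) P) ξ = _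
    rw [map_zero]
    rfl
  have hFδ : ∀ m ζ, F m (ζ ∘ₗ δ) = 0 := fun m ζ => by
    have := (f m).2
    rw [LinearMap.mem_ker] at this
    exact congrArg (fun φ => Nakayama.eval k φ ζ) this
  let Θ : (P →ₗ[A] M) →+ k :=
    { toFun := fun G => ∑ l, F (G (p l)) (η l)
      map_zero' := by simp [hF0]
      map_add' := fun G G' => by simp [hFadd, Finset.sum_add_distrib] }
  have hΘ : ∀ ξ m, Θ (rankOne ξ m) = F m ξ := fun ξ m => by
    have e : ξ = ∑ l, MulOpposite.op (ξ (p l)) • η l := by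
      ext x
      conv_lhs => rw [← hp x]
      simp
    conv_rhs => rw [e, map_sum]
    change ∑ l, F (rankOne ξ m (p l)) (η l) = _
    exact Finset.sum_congr rfl fun l _ => hFsmul (ξ (p l)) m (η l)
  ext m
  refine Nakayama.ext fun ξ => ?_
  change F m ξ = 0
  obtain ⟨l, hl⟩ := h (rankOne ξ m)
  have e : l ∘ₗ δ = ∑ j, rankOne (ζ j ∘ₗ δ) (l (q j)) := by
    ext x
    have := congrArg l (hq (δ x))
    simpa using this.symm
  rw [← hΘ, hl, e, map_sum]
  exact Finset.sum_eq_zero fun j _ => by rw [hΘ, hFδ]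

/-- If `g` did not extend, some `k`-linear functional would kill all maps factoring through `δ` but
not `g`. By duality it would be a nonzero map from `M` to the kernel. -/
theorem exists_extend_of_hom_ker [Module k M] [IsScalarTower k A M] [Module.Finite A P]
    [Module.Projective A P] {δ : P →ₗ[A] Q}
    (h : ∀ f : M →ₗ[A] LinearMap.ker (Nakayama.map k δ), f = 0) (g : P →ₗ[A] M) :
    ∃ l : Q →ₗ[A] M, g = l ∘ₗ δ := by
  have : SMulCommClass A k M := IsScalarTower.to_smulCommClass'
  obtain ⟨r, p, η, hp⟩ := exists_dualBasis (A := A) (P := P)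
  let W : Submodule k (P →ₗ[A] M) := LinearMap.range (LinearMap.lcomp k M δ)
  by_contra hg
  have hgW : g ∉ W := by
    rintro ⟨l, hl⟩
    exact hg ⟨l, hl.symm⟩
  obtain ⟨θ, hθ, hW⟩ := Submodule.exists_le_ker_of_notMem hgW
  let F : M →ₗ[A] LinearMap.ker (Nakayama.map k δ) :=
    { toFun := fun m => ⟨Nakayama.mk k (
          { toFun := fun ξ => θ (rankOne ξ m)
            map_add' := fun ξ ξ' => by
              rw [← map_add]; congr 1; ext x; simp [add_smul]
            map_smul' := fun c ξ => by
              rw [RingHom.id_apply, ← map_smul]; congr 1; ext x; simp }), by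
          refine Nakayama.ext fun ζ => ?_
          exact hW ⟨rankOne ζ m, rfl⟩⟩
      map_add' := fun m m' => Subtype.ext (Nakayama.ext fun ξ => by
        change θ _ = θ _ + θ _
        rw [← map_add]; congr 1; ext x; simp)
      map_smul' := fun a m => Subtype.ext (Nakayama.ext fun ξ => by
        change θ _ = θ _
        congr 1; ext x; simp [mul_smul]) }
  have hF : ∀ m ξ, θ (rankOne ξ m) = 0 := fun m ξ => by
    have : F m = (0 : LinearMap.ker (Nakayama.map k δ)) := LinearMap.congr_fun (h F) m
    exact congrArg (fun φ : LinearMap.ker (Nakayama.map k δ) => Nakayama.eval k φ.1 ξ) this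
  apply hθ
  have e : g = ∑ l, rankOne (η l) (g (p l)) := by
    ext x
    have := congrArg g (hp x)
    simpa using this.symm
  rw [e, map_sum]
  exact Finset.sum_eq_zero fun l _ => hF _ _

variable (k) in
theorem hom_ker_eq_zero_iff [Module.Finite A P] [Module.Projective A P] [Module.Finite A Q]
    [Module.Projective A Q] {δ : P →ₗ[A] Q} :
    (∀ f : M →ₗ[A] LinearMap.ker (Nakayama.map k δ), f = 0) ↔
      ∀ g : P →ₗ[A] M, ∃ l : Q →ₗ[A] M, g = l ∘ₗ δ := by
  refine ⟨fun h => ?_, fun h => hom_ker_eq_zero_of_extend h⟩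
  let _ : Module k M := Module.compHom M (algebraMap k A)
  have : IsScalarTower k A M := ⟨fun c a m => by
    change (c • a) • m = algebraMap k A c • a • m
    rw [Algebra.smul_def, mul_smul]⟩
  exact exists_extend_of_hom_ker h

end Nakayama

section Stable

variable {A : Type v} [Ring A]

/-- `K` is a direct summand of `R ⊕ U` for a projective module `U`. -/
def IsStableRetract (A : Type v) [Ring A] (K R : Type v) [AddCommGroup K] [Module A K]
    [AddCommGroup R] [Module A R] : Prop :=
  ∃ (U : ModuleCat.{v} A) (_ : Module.Projective A U) (a : K →ₗ[A] R) (b : R →ₗ[A] K)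
    (f : K →ₗ[A] U) (g : U →ₗ[A] K), ∀ x, b (a x) + g (f x) = x

variable {K R Q P Q₁ P₁ M : Type v} [AddCommGroup K] [Module A K]
    [AddCommGroup R] [Module A R] [AddCommGroup Q] [Module A Q] [AddCommGroup P] [Module A P]
    [AddCommGroup Q₁] [Module A Q₁] [AddCommGroup P₁] [Module A P₁] [AddCommGroup M] [Module A M]

theorem IsStableRetract.of_equiv (e : K ≃ₗ[A] R) : IsStableRetract A K R :=
  ⟨ModuleCat.of A PUnit.{v + 1}, inferInstanceAs (Module.Projective A PUnit.{v + 1}), e, e.symm, 0, 0,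
    fun x => by simp⟩

theorem exists_lift_of_range_le [Module.Projective A Q] (f : Q →ₗ[A] P) (e : P₁ →ₗ[A] P)
    (h : LinearMap.range f ≤ LinearMap.range e) : ∃ l : Q →ₗ[A] P₁, ∀ x, e (l x) = f x := by
  obtain ⟨l, hl⟩ := Module.projective_lifting_property e.rangeRestrict
    (f.codRestrict (LinearMap.range e) fun x => h ⟨x, rfl⟩) e.surjective_rangeRestrict
  exact ⟨l, fun x => congrArg Subtype.val (LinearMap.congr_fun hl x)⟩

/-- Lifts the retract data to the projectives. The summand through `U` becomes the homotopy term
`c`, since `g` lifts along `p`. -/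
theorem IsStableRetract.exists_lifts [Module.Projective A Q] [Module.Projective A P]
    (h : IsStableRetract A K R) {p : Q →ₗ[A] K} {q : P →ₗ[A] R} (hp : Function.Surjective p)
    (hq : Function.Surjective q) :
    ∃ (a : Q →ₗ[A] P) (b : P →ₗ[A] Q) (c : K →ₗ[A] Q), (∀ x, p x = 0 → q (a x) = 0) ∧
      (∀ x, q x = 0 → p (b x) = 0) ∧ ∀ x, p (x - b (a x) - c (p x)) = 0 := by
  obtain ⟨U, hU, a, b, f, g, hr⟩ := h
  obtain ⟨a', ha⟩ := Module.projective_lifting_property q (a ∘ₗ p) hq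
  obtain ⟨b', hb⟩ := Module.projective_lifting_property p (b ∘ₗ q) hp
  obtain ⟨g', hg⟩ := Module.projective_lifting_property p g hp
  replace ha : ∀ x, q (a' x) = a (p x) := LinearMap.congr_fun ha
  replace hb : ∀ x, p (b' x) = b (q x) := LinearMap.congr_fun hb
  replace hg : ∀ x, p (g' x) = g x := LinearMap.congr_fun hg
  refine ⟨a', b', g' ∘ₗ f, fun x hx => ?_, fun x hx => ?_, fun x => ?_⟩
  · rw [ha, hx, map_zero]
  · rw [hb, hx, map_zero]
  · rw [map_sub, map_sub, hb, ha, LinearMap.comp_apply, hg]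
    nth_rewrite 1 [← hr (p x)]
    abel

/-- A form of Schanuel's lemma: syzygies inherit the relation for any projective surjections, with
`Q` as the new projective summand. No minimality is needed. -/
theorem IsStableRetract.ker [Module.Projective A Q] [Module.Projective A P]
    (h : IsStableRetract A K R) {p : Q →ₗ[A] K} {q : P →ₗ[A] R} (hp : Function.Surjective p)
    (hq : Function.Surjective q) :
    IsStableRetract A (LinearMap.ker p) (LinearMap.ker q) := by
  obtain ⟨a, b, c, ha, hb, hc⟩ := h.exists_lifts hp hq
  refine ⟨ModuleCat.of A Q, inferInstanceAs (Module.Projective A Q),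
    a.restrict (fun x hx => ha x hx), b.restrict (fun x hx => hb x hx),
    (LinearMap.ker p).subtype,
    (LinearMap.id - b ∘ₗ a - c ∘ₗ p).codRestrict (LinearMap.ker p) (fun x => hc x),
    fun x => Subtype.ext ?_⟩
  have hx : p x = 0 := x.2
  change b (a x) + (x - b (a x) - c (p x)) = (x : Q)
  rw [hx, map_zero]
  abel

/-- With comparison maps `a₁`, `b₁` and homotopy `s`, put `r = 1 - b₁a₁ - sd`. Then `dr = 0`, so `r`
is nilpotent by `hnil`. Since `gb₁` extends along `e`, `g` equals `gr` modulo maps factoring through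
`d`, and iterating removes `gr`. The hypothesis `hnil` excludes a summand of `Q₁` on which `d`
vanishes. -/
theorem IsStableRetract.extend [Module.Projective A Q] [Module.Projective A P]
    [Module.Projective A Q₁] [Module.Projective A P₁]
    (h : IsStableRetract A K R) {p : Q →ₗ[A] K} {q : P →ₗ[A] R} (hp : Function.Surjective p)
    (hq : Function.Surjective q) {d : Q₁ →ₗ[A] Q} {e : P₁ →ₗ[A] P}
    (hd : LinearMap.range d = LinearMap.ker p) (he : LinearMap.range e = LinearMap.ker q)
    (hnil : ∀ r : Q₁ →ₗ[A] Q₁, d ∘ₗ r = 0 → IsNilpotent (r : Module.End A Q₁))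
    (hM : ∀ g : P₁ →ₗ[A] M, ∃ l : P →ₗ[A] M, g = l ∘ₗ e) (g : Q₁ →ₗ[A] M) :
    ∃ l : Q →ₗ[A] M, g = l ∘ₗ d := by
  obtain ⟨a, b, c, ha, hb, hc⟩ := h.exists_lifts hp hq
  have hpd : ∀ x, p (d x) = 0 := fun x => (hd ▸ LinearMap.mem_range_self d x : d x ∈ LinearMap.ker p)
  have hqe : ∀ x, q (e x) = 0 := fun x => (he ▸ LinearMap.mem_range_self e x : e x ∈ LinearMap.ker q)
  obtain ⟨a₁, ha₁⟩ := exists_lift_of_range_le (a ∘ₗ d) e (by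
    rintro _ ⟨x, rfl⟩
    rw [he]
    exact ha _ (hpd x))
  obtain ⟨b₁, hb₁⟩ := exists_lift_of_range_le (b ∘ₗ e) d (by
    rintro _ ⟨x, rfl⟩
    rw [hd]
    exact hb _ (hqe x))
  obtain ⟨s, hs⟩ := exists_lift_of_range_le (LinearMap.id - b ∘ₗ a - c ∘ₗ p) d (by
    rintro _ ⟨x, rfl⟩
    rw [hd]
    exact hc x)
  let r : Module.End A Q₁ := LinearMap.id - b₁ ∘ₗ a₁ - s ∘ₗ d
  have hr : d ∘ₗ r = 0 := by
    ext x
    have h1 := ha₁ x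
    have h2 := hb₁ (a₁ x)
    have h3 := hs (d x)
    simp only [LinearMap.comp_apply, LinearMap.sub_apply, LinearMap.id_apply, hpd, map_zero] at *
    simp only [r, LinearMap.sub_apply, LinearMap.id_apply, LinearMap.comp_apply, map_sub, h2, h3,
      h1, LinearMap.zero_apply]
    abel
  have step : ∀ g : Q₁ →ₗ[A] M, ∃ l : Q →ₗ[A] M, g = g ∘ₗ r + l ∘ₗ d := by
    intro g
    obtain ⟨l, hl⟩ := hM (g ∘ₗ b₁)
    refine ⟨l ∘ₗ a + g ∘ₗ s, ?_⟩
    ext x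
    have h1 := LinearMap.congr_fun hl (a₁ x)
    have h2 := ha₁ x
    simp only [LinearMap.comp_apply] at h1 h2
    simp only [r, LinearMap.sub_apply, LinearMap.id_apply, LinearMap.comp_apply, map_sub,
      LinearMap.add_apply, h1, h2]
    abel
  have iter : ∀ N : ℕ, ∃ l : Q →ₗ[A] M, g = g ∘ₗ (r ^ N : Module.End A Q₁) + l ∘ₗ d := by
    intro N
    induction N with
    | zero => exact ⟨0, by rw [pow_zero]; ext x; simp⟩
    | succ N ih =>
      obtain ⟨l, hl⟩ := ih
      obtain ⟨l', hl'⟩ := step (g ∘ₗ (r ^ N : Module.End A Q₁))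
      refine ⟨l + l', ?_⟩
      conv_lhs => rw [hl, hl']
      ext x
      simp only [pow_succ, LinearMap.add_apply, LinearMap.comp_apply, Module.End.mul_apply]
      abel
  obtain ⟨N, hN⟩ := hnil r hr
  obtain ⟨l, hl⟩ := iter N
  exact ⟨l, by rw [hl, hN]; ext x; simp⟩

end Stable

section Cover

variable (k : Type w) [Field k] {A : Type v} [Ring A] [Algebra k A] [Module.Finite k A]

-- The range of a high power of `r` complements its kernel and lies in the superfluous kernel of
-- `p`, so the kernel of that power is everything.
include k in
theorem IsProjectiveCover.isNilpotent {P M : FGModuleCat.{v} A} {p : P →ₗ[A] M}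
    (hp : IsProjectiveCover p) {r : P →ₗ[A] P} (hr : p ∘ₗ r = 0) :
    IsNilpotent (r : Module.End A P) := by
  have : IsArtinianRing A := IsArtinianRing.of_finite k A
  obtain ⟨m, hm⟩ := Filter.eventually_atTop.1
    (LinearMap.eventually_isCompl_ker_pow_range_pow (r : Module.End A P))
  have hc := hm (m + 1) (Nat.le_succ m)
  refine ⟨m + 1, ?_⟩
  rw [← LinearMap.ker_eq_top]
  apply hp.superfluous
  rw [eq_top_iff, ← hc.sup_eq_top]
  refine sup_le_sup_left ?_ _
  rintro _ ⟨x, rfl⟩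
  rw [pow_succ']
  exact LinearMap.congr_fun hr _

theorem range_presentationMap (M : FGModuleCat.{v} A) :
    LinearMap.range (presentationMap k M) = LinearMap.ker (coverMap k M) := by
  apply le_antisymm
  · rintro _ ⟨x, rfl⟩
    exact Subtype.prop (p := (· ∈ LinearMap.ker (coverMap k M))) (coverMap k (syzygy k M) x)
  · intro y hy
    obtain ⟨x, hx⟩ := (coverMap_isProjectiveCover k (syzygy k M)).surjective ⟨y, hy⟩
    exact ⟨x, congrArg Subtype.val hx⟩

theorem isNilpotent_of_presentationMap_comp {M : FGModuleCat.{v} A}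
    {r : cover k (syzygy k M) →ₗ[A] cover k (syzygy k M)} (hr : presentationMap k M ∘ₗ r = 0) :
    IsNilpotent (r : Module.End A (cover k (syzygy k M))) :=
  (coverMap_isProjectiveCover k (syzygy k M)).isNilpotent k
    (LinearMap.ext fun x => Subtype.ext (LinearMap.congr_fun hr x))

theorem homTauZero_iff_extend {m : ℕ} {M N : FGModuleCat.{v} A} :
    HomTauZero k (m + 1) M N ↔
      ∀ g : cover k (syzygy k ((syzygy k)^[m] N)) →ₗ[A] M,
        ∃ l : cover k ((syzygy k)^[m] N) →ₗ[A] M,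
          g = l ∘ₗ presentationMap k ((syzygy k)^[m] N) := by
  have := (coverMap_isProjectiveCover k (syzygy k ((syzygy k)^[m] N))).projective
  have := (coverMap_isProjectiveCover k ((syzygy k)^[m] N)).projective
  exact hom_ker_eq_zero_iff (M := M) k (δ := presentationMap k ((syzygy k)^[m] N))

end Cover

end TauTilting

/-! ### Comparison of `τₙ` with factorization through `add ΣT`. -/

namespace TauTilting

open Angulated Angulated.Seq

section Comparison

variable {C : Type u} [Category.{v} C] [Preadditive C]
  [HasZeroObject C] [HasBinaryBiproducts C] [HasFiniteBiproducts C]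
  {S : C ⥤ C} [S.Additive] {T : C}
  (k : Type w) [Field k] [Linear k C] [∀ X Y : C, Module.Finite k (X ⟶ Y)]

omit [HasZeroObject C] [HasBinaryBiproducts C] [HasFiniteBiproducts C] in
theorem range_postcomp {A B D : C} {f : A ⟶ B} {g : B ⟶ D} (h : ExactPair f g) :
    LinearMap.range (postcomp k T f) = LinearMap.ker (postcomp k T g) := by
  apply le_antisymm
  · rintro _ ⟨x, rfl⟩
    rw [LinearMap.mem_ker, ← LinearMap.comp_apply, ← postcomp_comp, h.zero, postcomp_zero,
      LinearMap.zero_apply]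
  · intro y hy
    obtain ⟨x, hx⟩ := h.lift (ofHom y) hy
    exact ⟨toHom k x, hx⟩

variable [S.Full] [S.Faithful] {m : ℕ} {𝒩 : Angulation S (m + 1)}

omit [S.Full] [S.Faithful] in
theorem surjective_postcomp (hT : IsClusterTilting 𝒩 T) {X Y U : C} {p : X ⟶ Y}
    {δ : Y ⟶ S.obj U} (hU : InAdd T U) (hp : ExactPair p δ) :
    Function.Surjective (postcomp k T p) := fun y => by
  obtain ⟨x, hx⟩ := hp.lift (ofHom y) (hom_eq_zero_of_inAdd hT.rigid (.refl T) hU _)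
  exact ⟨toHom k x, hx⟩

-- Maps from `N` to `add ΣT` factor through `δ` because `W` has none. For `t : Z₀ ⟶ M`, the
-- composite `δ ≫ Σt` vanishes exactly when `Σt` factors through `Σd`.
omit [HasZeroObject C] in
theorem factorZero_iff_of_exactPair (hT : ∀ f : T ⟶ S.obj T, f = 0) {Z₀ Z₁ W N : C}
    {d : Z₀ ⟶ Z₁} {p : W ⟶ N} {δ : N ⟶ S.obj Z₀} (h₁ : ExactPair p δ)
    (h₂ : ExactPair δ (S.map d)) (hZ₀ : InAdd T Z₀) (hW : InAdd T W) (M : C) :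
    FactorZero S T N (S.obj M) ↔ ∀ t : Z₀ ⟶ M, ∃ s : Z₁ ⟶ M, t = d ≫ s := by
  constructor
  · intro h t
    obtain ⟨s, hs⟩ := h₂.desc (S.map t) (h _ (hZ₀.map S) _ _)
    exact ⟨S.preimage s, S.map_injective (by rw [S.map_comp, S.map_preimage, hs])⟩
  · intro h
    rw [factorZero_iff]
    intro f g
    obtain ⟨f', rfl⟩ := h₁.desc f (hom_eq_zero_of_inAdd hT hW (.refl T) _)
    obtain ⟨s, hs⟩ := h (S.preimage (f' ≫ g))
    rw [Category.assoc, ← S.map_preimage (f' ≫ g), hs, S.map_comp, ← Category.assoc, h₂.zero,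
      zero_comp]

omit [HasZeroObject C] [HasBinaryBiproducts C] [HasFiniteBiproducts C] in
theorem postcomp_pow {X : C} (ρ : X ⟶ X) (N : ℕ) :
    postcomp k T ((End.of ρ ^ N : End X) : X ⟶ X) =
      (postcomp k T ρ : Module.End (End T)ᵐᵒᵖ ((homFunctor k T).obj X)) ^ N := by
  induction N with
  | zero => exact postcomp_id k X
  | succ N ih =>
    rw [pow_succ', pow_succ', ← ih]
    exact postcomp_comp k _ _

-- Minimality of the angle at `Z₀`: if `d` kills a retract `W` of `Z₀`, the inclusion `ΣW ⟶ ΣZ₀`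
-- lifts through `δ`. Then `ΣW` is a summand of `N` in `add ΣT`, hence zero.
include k in
omit [HasZeroObject C] [HasBinaryBiproducts C] [S.Full] in
theorem isNilpotent_of_comp_eq_zero [IsIdempotentComplete C] {Z₀ Z₁ N : C} {d : Z₀ ⟶ Z₁}
    {δ : N ⟶ S.obj Z₀} (h : ExactPair δ (S.map d)) (hZ₀ : InAdd T Z₀)
    (hd : AddDisjoint N (S.obj T)) {ρ : Z₀ ⟶ Z₀} (hρ : ρ ≫ d = 0) : IsNilpotent (End.of ρ) := by
  refine isNilpotent_of_retract k ρ fun W i p hip ⟨y, hy⟩ => ?_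
  have hi : i ≫ d = 0 := by
    have : i ≫ (p ≫ i) ≫ d = 0 := by rw [hy, Category.assoc, hρ, comp_zero, comp_zero]
    rwa [Category.assoc, ← Category.assoc, hip, Category.id_comp] at this
  obtain ⟨l, hl⟩ := h.lift (S.map i) (by rw [← S.map_comp, hi, S.map_zero])
  have hW : IsZero (S.obj W) := by
    refine hd _ ?_ ((hZ₀.of_comp i p hip).map S)
    refine (InAdd.refl _).of_comp l (δ ≫ S.map p) ?_
    rw [← Category.assoc, hl, ← S.map_comp, hip, S.map_id]
  rw [IsZero.iff_id_eq_zero]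
  apply S.map_injective
  rw [S.map_zero]
  exact hW.eq_of_src _ _

/-- `C(T, -)` turns the angle into a projective resolution of `N`, possibly not minimal, so its
images agree stably with the minimal syzygies. The induction runs down from the surjection onto `N`.
-/
theorem isStableRetract_range (hT : IsClusterTilting 𝒩 T) {Z : Seq S (m + 1)}
    (hZ : 𝒩.IsAngle Z) (hadd : ∀ i : Fin (m + 2), InAdd T (Z.obj i.castSucc))
    {N : FGModuleCat.{v} (End T)ᵐᵒᵖ}
    (e : (homFunctor k T).obj (Z.obj (Fin.last (m + 2))) ≃ₗ[(End T)ᵐᵒᵖ] N) (i : Fin (m + 2)) :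
    IsStableRetract (End T)ᵐᵒᵖ (LinearMap.range (postcomp k T (Z.map i)))
        ((syzygy k)^[m + 1 - i] N) ∧
      IsStableRetract (End T)ᵐᵒᵖ ((syzygy k)^[m + 1 - i] N)
        (LinearMap.range (postcomp k T (Z.map i))) := by
  induction i using Fin.reverseInduction with
  | last =>
    have hs : LinearMap.range (postcomp k T (Z.map (Fin.last (m + 1)))) = ⊤ :=
      LinearMap.range_eq_top.2 (surjective_postcomp k hT (hadd 0) (𝒩.exactPair_last hZ))
    have h0 : m + 1 - (Fin.last (m + 1) : Fin (m + 2)).val = 0 := by simp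
    rw [hs, h0]
    have e' : (⊤ : Submodule (End T)ᵐᵒᵖ ((homFunctor k T).obj (Z.obj (Fin.last (m + 2)))))
        ≃ₗ[(End T)ᵐᵒᵖ] N := Submodule.topEquiv.trans e
    exact ⟨.of_equiv e', .of_equiv e'.symm⟩
  | cast i ih =>
    have h0 : m + 1 - (i.castSucc : Fin (m + 2)).val = (m + 1 - (i.succ : Fin (m + 2)).val) + 1 := by
      have := i.2
      simp only [Fin.val_castSucc, Fin.val_succ]
      omega
    rw [h0, Function.iterate_succ_apply']
    obtain ⟨h1, h2⟩ := ih
    have := projective_of_inAdd k (hadd i.succ)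
    have := (coverMap_isProjectiveCover k ((syzygy k)^[m + 1 - (i.succ : Fin (m + 2)).val] N)).projective
    have hc := (coverMap_isProjectiveCover k ((syzygy k)^[m + 1 - (i.succ : Fin (m + 2)).val] N)).surjective
    have hr := range_postcomp k (T := T) (𝒩.exactPair i hZ)
    rw [← LinearMap.ker_rangeRestrict] at hr
    have hs := LinearMap.surjective_rangeRestrict (postcomp k T (Z.map i.succ))
    have k1 := h1.ker hs hc
    have k2 := h2.ker hc hs
    rw [← hr] at k1 k2
    exact ⟨k1, k2⟩

-- `IsStableRetract.extend` in both directions. The nilpotency comes from `hnil` on the side of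
-- `Z₀`, and from the projective cover on the other.
omit [HasZeroObject C] [HasBinaryBiproducts C] in
theorem extend_presentationMap_iff {Z₀ Z₁ Z₂ M₀ : C} {d : Z₀ ⟶ Z₁} {d' : Z₁ ⟶ Z₂}
    (h : ExactPair d d') (hZ₀ : InAdd T Z₀) (hZ₁ : InAdd T Z₁)
    (hnil : ∀ ρ : Z₀ ⟶ Z₀, ρ ≫ d = 0 → IsNilpotent (End.of ρ))
    {M R : FGModuleCat.{v} (End T)ᵐᵒᵖ} (eM : (homFunctor k T).obj M₀ ≃ₗ[(End T)ᵐᵒᵖ] M)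
    (s₁ : IsStableRetract (End T)ᵐᵒᵖ (LinearMap.range (postcomp k T d')) R)
    (s₂ : IsStableRetract (End T)ᵐᵒᵖ R (LinearMap.range (postcomp k T d'))) :
    (∀ g : cover k (syzygy k R) →ₗ[(End T)ᵐᵒᵖ] M, ∃ l : cover k R →ₗ[(End T)ᵐᵒᵖ] M,
      g = l ∘ₗ presentationMap k R) ↔ ∀ t : Z₀ ⟶ M₀, ∃ s : Z₁ ⟶ M₀, t = d ≫ s := by
  have := projective_of_inAdd k hZ₀
  have := projective_of_inAdd k hZ₁
  have := (coverMap_isProjectiveCover k R).projective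
  have := (coverMap_isProjectiveCover k (syzygy k R)).projective
  have hc := (coverMap_isProjectiveCover k R).surjective
  have hs := LinearMap.surjective_rangeRestrict (postcomp k T d')
  have hr := range_postcomp k (T := T) h
  rw [← LinearMap.ker_rangeRestrict] at hr
  constructor
  · intro h t
    obtain ⟨l, hl⟩ := s₁.extend hs hc hr (range_presentationMap k R) (fun r hr0 => by
        obtain ⟨ρ, rfl⟩ := exists_postcomp_eq k hZ₀ r
        have hρ : ρ ≫ d = 0 := postcomp_injective k hZ₀ (by
          rw [postcomp_comp, postcomp_zero]; exact hr0)
        obtain ⟨N, hN⟩ := hnil ρ hρ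
        exact ⟨N, by rw [← postcomp_pow, hN]; exact postcomp_zero k⟩)
      h (eM.toLinearMap ∘ₗ postcomp k T t)
    obtain ⟨s, hs⟩ := exists_postcomp_eq k hZ₁ (eM.symm.toLinearMap ∘ₗ l)
    refine ⟨s, postcomp_injective k hZ₀ (LinearMap.ext fun x => ?_)⟩
    have h1 : eM (postcomp k T t x) = _ := LinearMap.congr_fun hl x
    rw [postcomp_comp]
    apply eM.injective
    rw [h1]
    change _ = eM (postcomp k T s _)
    rw [hs]
    exact (eM.apply_symm_apply _).symm
  · intro h g
    refine s₂.extend hc hs (range_presentationMap k R) hr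
      (fun r hr => isNilpotent_of_presentationMap_comp k hr) (fun g => ?_) g
    obtain ⟨t, ht⟩ := exists_postcomp_eq k hZ₀ (eM.symm.toLinearMap ∘ₗ g)
    obtain ⟨s, rfl⟩ := h t
    refine ⟨eM.toLinearMap ∘ₗ postcomp k T s, LinearMap.ext fun x => ?_⟩
    have h1 : _ = eM.symm (g x) := LinearMap.congr_fun ht x
    rw [postcomp_comp] at h1
    exact (eM.symm_apply_eq.1 h1.symm)

theorem homTauZero_iff_factorZero [IsIdempotentComplete C] (hT : IsClusterTilting 𝒩 T) {M₀ N₀ : C}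
    (hN : AddDisjoint N₀ (S.obj T)) {M N : FGModuleCat.{v} (End T)ᵐᵒᵖ}
    (eM : (homFunctor k T).obj M₀ ≃ₗ[(End T)ᵐᵒᵖ] M)
    (eN : (homFunctor k T).obj N₀ ≃ₗ[(End T)ᵐᵒᵖ] N) :
    HomTauZero k (m + 1) M N ↔ FactorZero S T N₀ (S.obj M₀) := by
  obtain ⟨Z, hZ, hadd, ⟨e⟩⟩ := hT.exists_angle N₀
  have hd : AddDisjoint (Z.obj (Fin.last (m + 2))) (S.obj T) :=
    hN.of_inAdd ((InAdd.refl N₀).of_iso e)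
  have hfirst : ExactPair Z.last (S.map (Z.map (0 : Fin (m + 1)).castSucc)) :=
    𝒩.exactPair_first hZ
  -- Index `1` is the relevant one: the image of `Z₁ ⟶ Z₂` is stably `Ωᵐ N` with `m = n - 1`, and
  -- `Z₀ ⟶ Z₁` presents it.
  obtain ⟨s₁, s₂⟩ := isStableRetract_range k hT hZ hadd ((postcompEquiv k e).trans eN)
    (0 : Fin (m + 1)).succ
  have h0 : m + 1 - ((0 : Fin (m + 1)).succ).val = m := by simp
  rw [h0] at s₁ s₂
  rw [← factorZero_congr e (Iso.refl _), homTauZero_iff_extend]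
  exact (extend_presentationMap_iff k (𝒩.exactPair 0 hZ) (hadd 0) (hadd (0 : Fin (m + 1)).succ)
    (fun ρ hρ => isNilpotent_of_comp_eq_zero k hfirst (hadd 0) hd hρ) eM s₁ s₂).trans
      (factorZero_iff_of_exactPair hT.rigid (𝒩.exactPair_last hZ) hfirst (hadd 0)
        (hadd (Fin.last (m + 1))) M₀).symm

end Comparison

end TauTilting

/-! ### The dictionary between objects and pairs. -/

namespace TauTilting

open Angulated Angulated.Seq

section Correspondence

variable {C : Type u} [Category.{v} C] [Preadditive C]
  [HasZeroObject C] [HasBinaryBiproducts C] [HasFiniteBiproducts C]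
  {S : C ⥤ C} [S.Additive] {T : C}

omit [HasZeroObject C] [HasBinaryBiproducts C] in
theorem addDisjoint_of_inAdd (hT : ∀ f : T ⟶ S.obj T, f = 0) [S.IsEquivalence] {X : C}
    (hX : InAdd T X) : AddDisjoint X (S.obj T) := by
  intro Y hY hY'
  obtain ⟨Z, hZ, ⟨e⟩⟩ := exists_iso_map_of_inAdd S hY'
  rw [IsZero.iff_id_eq_zero, ← e.hom_inv_id, hom_eq_zero_of_inAdd hT (hX.trans hY) hZ e.hom,
    zero_comp]

omit [HasZeroObject C] [HasBinaryBiproducts C] [S.Additive] in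
theorem factorZero_of_inAdd_left {X Y W : C} (h : FactorZero S T X W) (hY : InAdd X Y) :
    FactorZero S T Y W := by
  intro Z hZ f g
  have key : ∀ t ∈ through X Y Y, t ≫ f ≫ g = 0 := by
    intro t ht
    induction ht using AddSubgroup.closure_induction with
    | mem t ht =>
      obtain ⟨a, b, rfl⟩ := ht
      have := h Z hZ (b ≫ f) g
      rw [Category.assoc] at this
      rw [Category.assoc, this, comp_zero]
    | zero => simp
    | add s t _ _ h1 h2 => rw [Preadditive.add_comp, h1, h2, add_zero]
    | neg s _ h1 => rw [Preadditive.neg_comp, h1, neg_zero]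
  simpa using key _ (inAdd_iff_mem_through.1 hY)

omit [HasZeroObject C] in
theorem factorZero_map_map [S.Full] (hT : ∀ f : T ⟶ S.obj T, f = 0) {U : C} (hU : InAdd T U)
    (W : C) : FactorZero S T W (S.obj (S.obj U)) := by
  rw [factorZero_iff]
  intro f g
  rw [← S.map_preimage g, hom_eq_zero_of_inAdd hT (.refl T) hU (S.preimage g), S.map_zero,
    comp_zero]

omit [HasZeroObject C] in
theorem factorZero_map_iff [S.Full] [S.Faithful] {U : C} (hU : InAdd T U) (N : C) :
    FactorZero S T (S.obj U) (S.obj N) ↔ ∀ t : U ⟶ N, t = 0 := by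
  constructor
  · intro h t
    apply S.map_injective
    simpa using h _ (hU.map S) (𝟙 _) (S.map t)
  · intro h
    rw [factorZero_iff]
    intro f g
    rw [← S.map_preimage (f ≫ g), h (S.preimage (f ≫ g)), S.map_zero]

-- Of the four blocks, the two into `ΣΣT_N` vanish by rigidity, and the one from `ΣT_M` to `ΣN₀` is
-- `C(T_M, N₀)` because `Σ` is fully faithful.
omit [HasZeroObject C] in
theorem factorZero_biprod_iff [S.Full] [S.Faithful] (hT : ∀ f : T ⟶ S.obj T, f = 0)
    {M₀ TM N₀ TN : C} (hTM : InAdd T TM) (hTN : InAdd T TN) :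
    FactorZero S T (M₀ ⊞ S.obj TM) (S.obj (N₀ ⊞ S.obj TN)) ↔
      FactorZero S T M₀ (S.obj N₀) ∧ ∀ t : TM ⟶ N₀, t = 0 := by
  have := preservesBinaryBiproducts_of_preservesBiproducts S
  rw [factorZero_congr (Iso.refl _) (S.mapBiprod _ _), factorZero_biprod_right,
    factorZero_biprod_left, factorZero_map_iff hTM]
  exact ⟨fun h => h.1, fun h => ⟨h, factorZero_map_map hT hTN _⟩⟩

variable (k : Type w) [Field k] [Linear k C] [∀ X Y : C, Module.Finite k (X ⟶ Y)]

-- Maps between the two kinds of summands cannot contribute: on `N₀` the part through `ΣT_M` is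
-- nilpotent, and on `ΣT_N` the part through `M₀` is.
include k in
omit [HasZeroObject C] in
theorem inAdd_biprod_iff [IsIdempotentComplete C] [S.Full] [S.Faithful] {M₀ TM N₀ TN : C}
    (hM : AddDisjoint M₀ (S.obj T)) (hN : AddDisjoint N₀ (S.obj T)) (hTM : InAdd T TM)
    (hTN : InAdd T TN) :
    InAdd (M₀ ⊞ S.obj TM) (N₀ ⊞ S.obj TN) ↔ InAdd M₀ N₀ ∧ InAdd TM TN := by
  constructor
  · intro h
    have h1 := h.of_comp (X := N₀) biprod.inl biprod.fst (by simp)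
    have h2 := h.of_comp (X := S.obj TN) biprod.inr biprod.snd (by simp)
    obtain ⟨x, hx, y, hy, e⟩ := exists_add_of_mem_through_biprod (inAdd_iff_mem_through.1 h1)
    obtain ⟨x', hx', y', hy', e'⟩ := exists_add_of_mem_through_biprod (inAdd_iff_mem_through.1 h2)
    constructor
    · have := isIso_add_of_isNilpotent (hN.isNilpotent k (mem_through_self y)
        ((hTM.map S).through_le hy)) ((add_comm y x).trans e.symm)
      rw [inAdd_iff_mem_through, ← IsIso.inv_hom_id x]
      exact comp_through hx _
    · exact (inAdd_map_iff S).1 (hM.inAdd_of_mem_through k (hTN.map S) hx' hy' e'.symm)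
  · rintro ⟨h1, h2⟩
    have hM₀ : InAdd (M₀ ⊞ S.obj TM) M₀ := (InAdd.refl _).of_comp biprod.inl biprod.fst (by simp)
    have hTM₀ : InAdd (M₀ ⊞ S.obj TM) (S.obj TM) :=
      (InAdd.refl _).of_comp biprod.inr biprod.snd (by simp)
    exact (hM₀.trans h1).biprod (hTM₀.trans (h2.map S))

omit [HasZeroObject C] [HasFiniteBiproducts C] in
theorem nonempty_biprod_equiv_prod {M₀ N₀ : C} {M N : FGModuleCat.{v} (End T)ᵐᵒᵖ}
    (eM : (homFunctor k T).obj M₀ ≃ₗ[(End T)ᵐᵒᵖ] M)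
    (eN : (homFunctor k T).obj N₀ ≃ₗ[(End T)ᵐᵒᵖ] N) :
    Nonempty ((homFunctor k T).obj (M₀ ⊞ N₀) ≃ₗ[(End T)ᵐᵒᵖ] FGModuleCat.of (End T)ᵐᵒᵖ (M × N)) := by
  let e : (homFunctor k T).obj (M₀ ⊞ N₀) ≃ₗ[(End T)ᵐᵒᵖ]
      (homFunctor k T).obj M₀ × (homFunctor k T).obj N₀ :=
    LinearEquiv.ofLinearMap
      ((postcomp k T biprod.fst).prod (postcomp k T biprod.snd))
      ((postcomp k T biprod.inl).coprod (postcomp k T biprod.inr))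
      (by
        refine LinearMap.ext fun ⟨x, y⟩ => Prod.ext ?_ ?_
        · change (ofHom x ≫ biprod.inl + ofHom y ≫ biprod.inr) ≫ biprod.fst = ofHom x
          simp
        · change (ofHom x ≫ biprod.inl + ofHom y ≫ biprod.inr) ≫ biprod.snd = ofHom y
          simp)
      (by
        refine LinearMap.ext fun x => ?_
        change (ofHom x ≫ biprod.fst) ≫ biprod.inl + (ofHom x ≫ biprod.snd) ≫ biprod.inr = ofHom x
        rw [Category.assoc, Category.assoc, ← Preadditive.comp_add, biprod.total, Category.comp_id])
  exact ⟨e.trans (eM.prodCongr eN)⟩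

variable (S T) in
/-- The data exhibiting `(M, P)` as the pair corresponding to `X`: a decomposition
`X ≅ M₀ ⊞ Σ T_M` with isomorphisms `C(T, M₀) ≃ M` and `C(T, T_M) ≃ P`. -/
structure Corresponds (X : C) (M P : FGModuleCat.{v} (End T)ᵐᵒᵖ) (M₀ TM : C) where
  disjoint : AddDisjoint M₀ (S.obj T)
  mem : InAdd T TM
  iso : X ≅ M₀ ⊞ S.obj TM
  equiv : (homFunctor k T).obj M₀ ≃ₗ[(End T)ᵐᵒᵖ] M
  equiv' : (homFunctor k T).obj TM ≃ₗ[(End T)ᵐᵒᵖ] P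

namespace Corresponds

variable {k} {X Y M₀ N₀ TM TN : C} {M N P Q : FGModuleCat.{v} (End T)ᵐᵒᵖ}
  (c : Corresponds S T k X M P M₀ TM) (c' : Corresponds S T k Y N Q N₀ TN)

include c

omit [HasZeroObject C] [S.Additive] in
theorem imageD_left : imageD k T M :=
  ⟨M₀, ⟨c.equiv.toFGModuleCatIso⟩⟩

omit [HasZeroObject C] [S.Additive] in
theorem projective : Module.Projective (End T)ᵐᵒᵖ P :=
  have := projective_of_inAdd k c.mem
  Module.Projective.of_equiv c.equiv'

omit [HasZeroObject C] [S.Additive] in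
theorem hom_eq_zero_iff (eN : (homFunctor k T).obj N₀ ≃ₗ[(End T)ᵐᵒᵖ] N) :
    (∀ f : P →ₗ[(End T)ᵐᵒᵖ] N, f = 0) ↔ ∀ t : TM ⟶ N₀, t = 0 := by
  constructor
  · intro h t
    refine postcomp_injective k c.mem ?_
    have := h (eN.toLinearMap ∘ₗ postcomp k T t ∘ₗ c.equiv'.symm.toLinearMap)
    rw [postcomp_zero]
    refine LinearMap.ext fun x => eN.injective ?_
    simpa using LinearMap.congr_fun this (c.equiv' x)
  · intro h f
    obtain ⟨t, ht⟩ := exists_postcomp_eq k c.mem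
      (eN.symm.toLinearMap ∘ₗ f ∘ₗ c.equiv'.toLinearMap)
    rw [h t, postcomp_zero] at ht
    refine LinearMap.ext fun x => eN.symm.injective ?_
    simpa using (LinearMap.congr_fun ht (c.equiv'.symm x)).symm

variable [IsIdempotentComplete C] [S.IsEquivalence] {m : ℕ} {𝒩 : Angulation S (m + 1)}
  (hT : IsClusterTilting 𝒩 T)

include c' hT

/-- Translates every vanishing condition in the theorem. The order is reversed: the source `X`
supplies the module under `τₙ` and the projective. -/
theorem factorZero_iff : FactorZero S T X (S.obj Y) ↔
    HomTauZero k (m + 1) N M ∧ ∀ f : P →ₗ[(End T)ᵐᵒᵖ] N, f = 0 := by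
  rw [factorZero_congr c.iso (S.mapIso c'.iso), factorZero_biprod_iff hT.rigid c.mem c'.mem,
    c.hom_eq_zero_iff c'.equiv, homTauZero_iff_factorZero k hT c.disjoint c'.equiv c.equiv]

theorem inAdd_iff : InAdd X Y ↔ ModInAdd M N ∧ ModInAdd P Q := by
  have h : InAdd X Y ↔ InAdd (M₀ ⊞ S.obj TM) (N₀ ⊞ S.obj TN) :=
    ⟨fun h => (h.of_iso c'.iso.symm).of_iso_left c.iso,
      fun h => (h.of_iso c'.iso).of_iso_left c.iso.symm⟩
  have key : ∀ {U V : C} {K L : FGModuleCat.{v} (End T)ᵐᵒᵖ}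
      (_ : (homFunctor k T).obj U ≃ₗ[(End T)ᵐᵒᵖ] K) (_ : (homFunctor k T).obj V ≃ₗ[(End T)ᵐᵒᵖ] L),
      AddDisjoint V (S.obj T) → (ModInAdd K L ↔ InAdd U V) := by
    intro U V K L eK eL hV
    have iK : ((homFunctor k T).obj U).obj ≅ K.obj := eK.toModuleIso
    have iL : ((homFunctor k T).obj V).obj ≅ L.obj := eL.toModuleIso
    exact ⟨fun h => inAdd_of_modInAdd k hT hV ((InAdd.of_iso iL h).of_iso_left iK.symm),
      fun h => InAdd.of_iso_left iK (InAdd.of_iso iL.symm (modInAdd_of_inAdd k h))⟩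
  rw [h, inAdd_biprod_iff k c.disjoint c'.disjoint c.mem c'.mem,
    key c.equiv c'.equiv c'.disjoint,
    key c.equiv' c'.equiv' (addDisjoint_of_inAdd hT.rigid c'.mem)]

omit c' in
theorem isRelRigid_iff :
    IsRelRigid S T X ↔ IsTauRigidPair k (m + 1) (imageD k T) M P :=
  (c.factorZero_iff c hT).trans
    ⟨fun h => ⟨c.imageD_left, c.projective, h.1, h.2⟩, fun h => ⟨h.rigid, h.hom_zero⟩⟩

omit c' hT [HasZeroObject C] [S.Additive] [S.IsEquivalence] in
theorem exists_biprod (hN : AddDisjoint N₀ (S.obj T))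
    (eN : (homFunctor k T).obj N₀ ≃ₗ[(End T)ᵐᵒᵖ] N) :
    Nonempty (Corresponds S T k (X ⊞ N₀) (FGModuleCat.of (End T)ᵐᵒᵖ (M × N)) P (M₀ ⊞ N₀) TM) := by
  obtain ⟨e⟩ := nonempty_biprod_equiv_prod k c.equiv eN
  exact ⟨⟨c.disjoint.biprod k hN, c.mem, biprod.mapIso c.iso (Iso.refl _) ≪≫
    biprod.associator _ _ _ ≪≫ biprod.mapIso (Iso.refl _) (biprod.braiding _ _) ≪≫
    (biprod.associator _ _ _).symm, e, c.equiv'⟩⟩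

end Corresponds

end Correspondence

end TauTilting

/-! ### Matching the maximality conditions, and the bijections. -/

namespace TauTilting

open Angulated Angulated.Seq

section Bijection

variable {C : Type u} [Category.{v} C] [Preadditive C]
  [HasZeroObject C] [HasBinaryBiproducts C] [HasFiniteBiproducts C]
  {S : C ⥤ C} [S.Additive] {T : C}
  (k : Type w) [Field k] [Linear k C] [∀ X Y : C, Module.Finite k (X ⟶ Y)]

omit [HasBinaryBiproducts C] [HasFiniteBiproducts C] in
theorem homFunctor_obj_zero (x : (homFunctor k T).obj (0 : C)) : x = 0 :=
  (isZero_zero C).eq_of_tgt (ofHom x) 0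

omit [HasBinaryBiproducts C] [HasFiniteBiproducts C] in
theorem eq_zero_of_source_zero {L : Type*} [AddCommGroup L] [Module (End T)ᵐᵒᵖ L]
    (f : (homFunctor k T).obj (0 : C) →ₗ[(End T)ᵐᵒᵖ] L) : f = 0 :=
  LinearMap.ext fun x => by rw [homFunctor_obj_zero k x, map_zero, map_zero]

omit [HasBinaryBiproducts C] [HasFiniteBiproducts C] in
theorem eq_zero_of_target_zero {L : Type*} [AddCommGroup L] [Module (End T)ᵐᵒᵖ L]
    (f : L →ₗ[(End T)ᵐᵒᵖ] (homFunctor k T).obj (0 : C)) : f = 0 :=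
  LinearMap.ext fun _ => homFunctor_obj_zero k _

omit [HasBinaryBiproducts C] [HasFiniteBiproducts C] in
theorem modInAdd_zero (M : FGModuleCat.{v} (End T)ᵐᵒᵖ) :
    ModInAdd M ((homFunctor k T).obj (0 : C)) := by
  refine InAdd.of_isZero ((IsZero.iff_id_eq_zero _).2 ?_)
  exact ModuleCat.hom_ext (eq_zero_of_source_zero k _)

omit [HasBinaryBiproducts C] [S.Additive] in
theorem addDisjoint_zero : AddDisjoint (0 : C) (S.obj T) := fun X hX _ => by
  obtain ⟨r, ⟨ρ⟩⟩ := hX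
  rw [IsZero.iff_id_eq_zero, ← ρ.retract]
  have h : 𝟙 (⨁ fun _ : Fin r => (0 : C)) = 0 := by
    ext
  rw [← Category.id_comp ρ.r, h, zero_comp, comp_zero]

variable [IsIdempotentComplete C] [S.IsEquivalence] {m : ℕ} {𝒩 : Angulation S (m + 1)}
  (hT : IsClusterTilting 𝒩 T)

omit [HasZeroObject C] [S.Additive] [S.IsEquivalence] in
theorem nonempty_corresponds_of_isDecomposition {X M₀ TM : C} (h : IsDecomposition S T X M₀ TM) :
    Nonempty (Corresponds S T k X ((homFunctor k T).obj M₀) ((homFunctor k T).obj TM) M₀ TM) := by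
  obtain ⟨e⟩ := h.iso
  exact ⟨⟨h.addDisjoint k, h.mem, e, .refl _ _, .refl _ _⟩⟩

theorem exists_corresponds (X : C) :
    ∃ M P M₀ TM, Nonempty (Corresponds S T k X M P M₀ TM) := by
  obtain ⟨M₀, TM, h⟩ := exists_isDecomposition k (S := S) T X
  exact ⟨_, _, M₀, TM, nonempty_corresponds_of_isDecomposition k h⟩

/-- Adding an object of `add ΣT` to `X` does not change `C(T, X)`. -/
def inlEquiv (X : C) {U : C} (hU : InAdd (S.obj T) U) :
    (homFunctor k T).obj X ≃ₗ[(End T)ᵐᵒᵖ] (homFunctor k T).obj (X ⊞ U) :=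
  have h0 : postcomp k T (biprod.fst ≫ biprod.inl : X ⊞ U ⟶ _) = LinearMap.id := by
    have h1 : (biprod.fst ≫ biprod.inl : X ⊞ U ⟶ _) = 𝟙 _ - biprod.snd ≫ biprod.inr := by
      rw [← biprod.total]; abel
    rw [h1, postcomp_sub, postcomp_id, postcomp_eq_zero_of_mem_through k hT
      (comp_through (hU.mem_through biprod.inr) _), sub_zero]
  LinearEquiv.ofLinearMap (postcomp k T biprod.inl) (postcomp k T biprod.fst)
    (by rw [← postcomp_comp, h0]) (by rw [← postcomp_comp, biprod.inl_fst, postcomp_id])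

-- Cancellation: the part of `𝟙 U` passing through `B` is nilpotent, so the part through `V` is
-- invertible.
include k in
omit [HasZeroObject C] [S.Additive] [S.IsEquivalence] in
theorem nonempty_retract_of_biprod_iso {A B U V : C} (hB : AddDisjoint B (S.obj T))
    (hU : InAdd (S.obj T) U) (e : A ⊞ U ≅ B ⊞ V) : Nonempty (Retract U V) := by
  have h : (biprod.inr ≫ e.hom ≫ biprod.fst) ≫ (biprod.inl ≫ e.inv ≫ biprod.snd) +
      (biprod.inr ≫ e.hom ≫ biprod.snd) ≫ (biprod.inr ≫ e.inv ≫ biprod.snd) = 𝟙 U := by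
    have h' : biprod.inr ≫ e.hom ≫ (biprod.fst ≫ biprod.inl + biprod.snd ≫ biprod.inr) ≫ e.inv ≫
        biprod.snd = 𝟙 U := by
      rw [biprod.total, Category.id_comp]
      simp
    rw [← h', Preadditive.add_comp, Preadditive.comp_add, Preadditive.comp_add]
    simp only [Category.assoc]
  have := isIso_add_of_isNilpotent (hB.isNilpotent k (comp_mem_through _ _) (hU.mem_through _)) h
  exact ⟨⟨biprod.inr ≫ e.hom ≫ biprod.snd, (biprod.inr ≫ e.inv ≫ biprod.snd) ≫
    inv ((biprod.inr ≫ e.hom ≫ biprod.snd) ≫ (biprod.inr ≫ e.inv ≫ biprod.snd)), by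
      rw [← Category.assoc, IsIso.hom_inv_id]⟩⟩

include hT in
theorem exists_equiv_of_imageD {N : FGModuleCat.{v} (End T)ᵐᵒᵖ} (hN : imageD k T N) :
    ∃ N₀ : C, AddDisjoint N₀ (S.obj T) ∧
      Nonempty ((homFunctor k T).obj N₀ ≃ₗ[(End T)ᵐᵒᵖ] N) := by
  obtain ⟨Y, ⟨e⟩⟩ := hN
  obtain ⟨N₀, TN, h⟩ := exists_isDecomposition k (S := S) T Y
  obtain ⟨e'⟩ := h.iso
  exact ⟨N₀, h.addDisjoint k, ⟨((inlEquiv k hT N₀ (h.mem.map S)).trans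
    (postcompEquiv k e'.symm)).trans (FGModuleCat.isoToLinearEquiv e)⟩⟩

namespace Corresponds

variable {k} {X Y M₀ N₀ TM TN : C} {M N P Q : FGModuleCat.{v} (End T)ᵐᵒᵖ}
  (c : Corresponds S T k X M P M₀ TM)

include c hT

theorem homTauZero_zero : HomTauZero k (m + 1) M ((homFunctor k T).obj (0 : C)) := by
  rw [homTauZero_iff_factorZero k hT addDisjoint_zero c.equiv (.refl _ _)]
  intro Z _ f g
  exact (isZero_zero C).eq_of_src _ _

omit c hT [HasBinaryBiproducts C] [HasFiniteBiproducts C] [IsIdempotentComplete C] in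
theorem zero_homTauZero (L : FGModuleCat.{v} (End T)ᵐᵒᵖ) :
    HomTauZero k (m + 1) ((homFunctor k T).obj (0 : C)) L :=
  fun f => eq_zero_of_source_zero k f

theorem isMaxRelRigid_iff :
    IsMaxRelRigid S T X ↔ IsSupportTauTiltingPair k (m + 1) (imageD k T) M P := by
  have rigid_biprod : ∀ {A B : C}, IsRelRigid S T (A ⊞ B) ↔
      (FactorZero S T A (S.obj A) ∧ FactorZero S T B (S.obj A)) ∧
        (FactorZero S T A (S.obj B) ∧ FactorZero S T B (S.obj B)) := by
    intro A B
    have := preservesBinaryBiproducts_of_preservesBiproducts S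
    rw [IsRelRigid, factorZero_congr (Iso.refl _) (S.mapBiprod _ _), factorZero_biprod_right,
      factorZero_biprod_left, factorZero_biprod_left]
  constructor
  · rintro ⟨hr, hmax⟩
    have hp := (c.isRelRigid_iff hT).1 hr
    refine ⟨hp, fun N hN hpair => ?_, fun Q hQ => ?_⟩
    · obtain ⟨N₀, hN₀, ⟨eN⟩⟩ := exists_equiv_of_imageD k hT hN
      obtain ⟨b⟩ := c.exists_biprod hN₀ eN
      have hX := hmax N₀ ((b.isRelRigid_iff hT).2 hpair)
      -- The pair `(N, 0)` is the test object for condition (i); the pair `(0, Q)` below is the one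
      -- for (ii).
      let c' : Corresponds S T k (N₀ ⊞ S.obj 0) N ((homFunctor k T).obj (0 : C)) N₀ 0 :=
        ⟨hN₀, .of_isZero (isZero_zero C), Iso.refl _, eN, .refl _ _⟩
      refine ((c.inAdd_iff c' hT).1 ?_).1
      have hS : IsZero (S.obj (0 : C)) := S.map_isZero (isZero_zero C)
      exact hX.biprod (.of_isZero hS)
    · obtain ⟨TQ, hTQ, ⟨eQ⟩⟩ := exists_iso_of_projective k Q hQ
      let c' : Corresponds S T k ((0 : C) ⊞ S.obj TQ) ((homFunctor k T).obj (0 : C)) Q 0 TQ :=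
        ⟨addDisjoint_zero, hTQ, Iso.refl _, .refl _ _, eQ⟩
      have hXY := c.inAdd_iff c' hT
      have h1 := c'.factorZero_iff c hT
      constructor
      · intro h
        exact (h1.1 (factorZero_of_inAdd_left hr (hXY.2 ⟨modInAdd_zero k M, h⟩))).2
      · intro h
        refine (hXY.1 (hmax _ (rigid_biprod.2 ⟨⟨hr, ?_⟩, ?_, ?_⟩))).2
        · exact h1.2 ⟨c.homTauZero_zero hT, h⟩
        · exact (c.factorZero_iff c' hT).2 ⟨zero_homTauZero M, eq_zero_of_target_zero k⟩
        · exact (c'.factorZero_iff c' hT).2 ⟨zero_homTauZero _, eq_zero_of_target_zero k⟩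
  · intro h
    refine ⟨(c.isRelRigid_iff hT).2 h.rigidPair, fun Y hXY => ?_⟩
    obtain ⟨⟨hXX, hYX⟩, hXY, hYY⟩ := rigid_biprod.1 hXY
    obtain ⟨N, Q, N₀, TN, ⟨c'⟩⟩ := exists_corresponds k (S := S) (T := T) Y
    rw [c'.factorZero_iff c hT] at hYX
    rw [c.factorZero_iff c' hT] at hXY
    rw [c'.factorZero_iff c' hT] at hYY
    let c₀ : Corresponds S T k (N₀ ⊞ S.obj 0) N ((homFunctor k T).obj (0 : C)) N₀ 0 :=
      ⟨c'.disjoint, .of_isZero (isZero_zero C), Iso.refl _, c'.equiv, .refl _ _⟩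
    -- The two halves of `Y` are treated separately: `support` absorbs the projective `Q`, and
    -- `maximal` absorbs `N` once `X ⊞ N₀` is known to be rigid.
    refine (c.inAdd_iff c' hT).2 ⟨?_, (h.support Q c'.projective).2 hYX.2⟩
    obtain ⟨b⟩ := c.exists_biprod c'.disjoint c'.equiv
    refine h.maximal N c'.imageD_left ((b.isRelRigid_iff hT).1 (rigid_biprod.2 ?_))
    have hN₀ : ∀ Z : C, FactorZero S T Z (S.obj (N₀ ⊞ S.obj 0)) → FactorZero S T Z (S.obj N₀) :=
      fun Z h => h.of_comp_right (S.map biprod.inl) (S.map biprod.fst)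
        (by rw [← S.map_comp, biprod.inl_fst, S.map_id])
    have hN₀' : ∀ Z : C, FactorZero S T (N₀ ⊞ S.obj 0) Z → FactorZero S T N₀ Z :=
      fun Z h => h.of_comp_left biprod.inl biprod.fst biprod.inl_fst
    exact ⟨⟨hXX, hN₀' _ ((c₀.factorZero_iff c hT).2 ⟨hYX.1, eq_zero_of_source_zero k⟩)⟩,
      hN₀ _ ((c.factorZero_iff c₀ hT).2 hXY),
      hN₀ _ (hN₀' _ ((c₀.factorZero_iff c₀ hT).2 ⟨hYY.1, eq_zero_of_source_zero k⟩))⟩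

theorem isRelSelfPerp_iff :
    IsRelSelfPerp S T X ↔ IsMaxTauRigidPair k (m + 1) (imageD k T) M P := by
  constructor
  · intro h
    refine ⟨c.imageD_left, c.projective, fun N hN => ?_, fun Q hQ => ?_⟩
    · obtain ⟨N₀, hN₀, ⟨eN⟩⟩ := exists_equiv_of_imageD k hT hN
      let c' : Corresponds S T k (N₀ ⊞ S.obj 0) N ((homFunctor k T).obj (0 : C)) N₀ 0 :=
        ⟨hN₀, .of_isZero (isZero_zero C), Iso.refl _, eN, .refl _ _⟩
      have := h (N₀ ⊞ S.obj 0)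
      rw [c.inAdd_iff c' hT, c.factorZero_iff c' hT, c'.factorZero_iff c hT] at this
      constructor
      · intro hN
        obtain ⟨⟨h1, h2⟩, h3, -⟩ := this.1 ⟨hN, modInAdd_zero k P⟩
        exact ⟨h3, h1, h2⟩
      · rintro ⟨h1, h2, h3⟩
        exact (this.2 ⟨⟨h2, h3⟩, h1, eq_zero_of_source_zero k⟩).1
    · obtain ⟨TQ, hTQ, ⟨eQ⟩⟩ := exists_iso_of_projective k Q hQ
      let c' : Corresponds S T k ((0 : C) ⊞ S.obj TQ) ((homFunctor k T).obj (0 : C)) Q 0 TQ :=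
        ⟨addDisjoint_zero, hTQ, Iso.refl _, .refl _ _, eQ⟩
      have := h ((0 : C) ⊞ S.obj TQ)
      rw [c.inAdd_iff c' hT, c.factorZero_iff c' hT, c'.factorZero_iff c hT] at this
      constructor
      · intro hQ
        exact (this.1 ⟨modInAdd_zero k M, hQ⟩).2.2
      · intro hQ
        exact (this.2 ⟨⟨zero_homTauZero M, eq_zero_of_target_zero k⟩,
          c.homTauZero_zero hT, hQ⟩).2
  · intro h Y
    obtain ⟨N, Q, N₀, TN, ⟨c'⟩⟩ := exists_corresponds k (S := S) (T := T) Y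
    rw [c.inAdd_iff c' hT, c.factorZero_iff c' hT, c'.factorZero_iff c hT,
      h.maximal N c'.imageD_left, h.support Q c'.projective]
    tauto

/-- The assignment is well defined. The module is `C(T, X)` itself, as `C(T, -)` kills the `ΣT`
part. For the projective, cancellation makes the two `ΣT` parts retracts of each other. -/
theorem nonempty_equiv {X' M₀' TM' : C} {M' P' : FGModuleCat.{v} (End T)ᵐᵒᵖ}
    (c' : Corresponds S T k X' M' P' M₀' TM') (e : X ≅ X') :
    Nonempty (M ≃ₗ[(End T)ᵐᵒᵖ] M') ∧ Nonempty (P ≃ₗ[(End T)ᵐᵒᵖ] P') := by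
  have i := c.iso.symm ≪≫ e ≪≫ c'.iso
  obtain ⟨r⟩ := nonempty_retract_of_biprod_iso k c'.disjoint (c.mem.map S) i
  obtain ⟨r'⟩ := nonempty_retract_of_biprod_iso k c.disjoint (c'.mem.map S) i.symm
  obtain ⟨f⟩ := nonempty_iso_of_retracts k r r'
  exact ⟨⟨c.equiv.symm.trans ((inlEquiv k hT M₀ (c.mem.map S)).trans ((postcompEquiv k i).trans
    ((inlEquiv k hT M₀' (c'.mem.map S)).symm.trans c'.equiv)))⟩,
    ⟨c.equiv'.symm.trans ((postcompEquiv k (S.preimageIso f)).trans c'.equiv')⟩⟩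

theorem nonempty_iso {X' M₀' TM' : C} (c' : Corresponds S T k X' M P M₀' TM') :
    Nonempty (X ≅ X') := by
  obtain ⟨e⟩ := nonempty_iso_of_homFunctor k hT c.disjoint c'.disjoint
    (c.equiv.trans c'.equiv.symm)
  obtain ⟨e'⟩ := nonempty_iso_of_homFunctor k hT (addDisjoint_of_inAdd hT.rigid c.mem)
    (addDisjoint_of_inAdd hT.rigid c'.mem) (c.equiv'.trans c'.equiv'.symm)
  exact ⟨c.iso ≪≫ biprod.mapIso e (S.mapIso e') ≪≫ c'.iso.symm⟩

end Corresponds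

omit [HasZeroObject C] [HasBinaryBiproducts C] [HasFiniteBiproducts C] [IsIdempotentComplete C] in
theorem isoClass_prod_eq_iff {M P M' P' : FGModuleCat.{v} (End T)ᵐᵒᵖ} :
    isoClass (M, P) = isoClass (M', P') ↔
      Nonempty (M ≃ₗ[(End T)ᵐᵒᵖ] M') ∧ Nonempty (P ≃ₗ[(End T)ᵐᵒᵖ] P') := by
  refine Quotient.eq.trans ⟨fun ⟨e⟩ => ?_, fun ⟨⟨e⟩, ⟨e'⟩⟩ => ?_⟩
  · exact ⟨⟨FGModuleCat.isoToLinearEquiv ((CategoryTheory.Prod.fst _ _).mapIso e)⟩,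
      ⟨FGModuleCat.isoToLinearEquiv ((CategoryTheory.Prod.snd _ _).mapIso e)⟩⟩
  · exact ⟨Iso.prod e.toFGModuleCatIso e'.toFGModuleCatIso⟩

-- `Φ` is already injective on all isomorphism classes and reaches every pair of a module in the
-- image and a projective. A property that transfers along `Corresponds` therefore restricts to a
-- bijection, which gives (b), (c) and (d) together.
include hT in
theorem bijOn_of_corresponds
    {Φ : Quotient (isIsomorphicSetoid C) → Quotient (isIsomorphicSetoid
      (FGModuleCat.{v} (End T)ᵐᵒᵖ × FGModuleCat.{v} (End T)ᵐᵒᵖ))}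
    (hΦ : ∀ {X M P M₀ TM}, Corresponds S T k X M P M₀ TM → Φ (isoClass X) = isoClass (M, P))
    {p : C → Prop} {p' : FGModuleCat.{v} (End T)ᵐᵒᵖ → FGModuleCat.{v} (End T)ᵐᵒᵖ → Prop}
    (hp : ∀ {X M P M₀ TM}, Corresponds S T k X M P M₀ TM → (p X ↔ p' M P))
    (hp' : ∀ {M P}, p' M P → imageD k T M ∧ Module.Projective (End T)ᵐᵒᵖ P) :
    Set.BijOn Φ (isoClass '' {X | p X}) (isoClass '' {q | p' q.1 q.2}) := by
  refine ⟨?_, ?_, ?_⟩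
  · rintro _ ⟨X, hX, rfl⟩
    obtain ⟨M, P, M₀, TM, ⟨c⟩⟩ := exists_corresponds k (S := S) (T := T) X
    exact ⟨(M, P), (hp c).1 hX, (hΦ c).symm⟩
  · rintro _ ⟨X, -, rfl⟩ _ ⟨Y, -, rfl⟩ hXY
    obtain ⟨M, P, M₀, TM, ⟨c⟩⟩ := exists_corresponds k (S := S) (T := T) X
    obtain ⟨N, Q, N₀, TN, ⟨c'⟩⟩ := exists_corresponds k (S := S) (T := T) Y
    rw [hΦ c, hΦ c', isoClass_prod_eq_iff] at hXY
    obtain ⟨⟨e⟩, ⟨e'⟩⟩ := hXY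
    exact Quotient.sound (c.nonempty_iso hT
      ⟨c'.disjoint, c'.mem, c'.iso, c'.equiv.trans e.symm, c'.equiv'.trans e'.symm⟩)
  · rintro _ ⟨⟨M, P⟩, hMP, rfl⟩
    obtain ⟨hM, hP⟩ := hp' hMP
    obtain ⟨M₀, hM₀, ⟨e⟩⟩ := exists_equiv_of_imageD k hT hM
    obtain ⟨TP, hTP, ⟨e'⟩⟩ := exists_iso_of_projective k P hP
    have c : Corresponds S T k (M₀ ⊞ S.obj TP) M P M₀ TP := ⟨hM₀, hTP, Iso.refl _, e, e'⟩
    exact ⟨isoClass (M₀ ⊞ S.obj TP), ⟨_, (hp c).2 hMP, rfl⟩, hΦ c⟩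

end Bijection

end TauTilting

end

theorem theorem3p7 {k : Type w} [Field k]
    {C : Type u} [Category.{v} C] [Preadditive C] [Linear k C]
    [HasZeroObject C] [HasBinaryBiproducts C] [HasFiniteBiproducts C]
    [IsIdempotentComplete C] [∀ X Y : C, Module.Finite k (X ⟶ Y)]
    (n : ℕ) (hn : 0 < n) (S : C ⥤ C) [S.IsEquivalence] [S.Additive]
    (𝒩 : Angulated.Angulation S n) (T : C) (hT : Angulated.IsClusterTilting 𝒩 T) :
    (∀ M : C,
      (∀ X : C, Angulated.InAdd M X → Angulated.InAdd (S.obj T) X → IsZero X) →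
      (Angulated.IsRelRigid S T M ↔
        TauTilting.IsTauRigid k n ((TauTilting.homFunctor k T).obj M))) ∧
    (∀ M : C, ∃ M₀ TM : C, Angulated.IsDecomposition S T M M₀ TM) ∧
    ∃ Φ : Quotient (isIsomorphicSetoid C) →
        Quotient (isIsomorphicSetoid
          (FGModuleCat.{v} (End T)ᵐᵒᵖ × FGModuleCat.{v} (End T)ᵐᵒᵖ)),
      (∀ M M₀ TM : C, Angulated.IsDecomposition S T M M₀ TM →
        Φ (isoClass M) =
          isoClass ((TauTilting.homFunctor k T).obj M₀, (TauTilting.homFunctor k T).obj TM)) ∧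
      Set.BijOn Φ (isoClass '' {M | Angulated.IsRelRigid S T M})
        (isoClass '' {p | TauTilting.IsTauRigidPair k n (TauTilting.imageD k T) p.1 p.2}) ∧
      Set.BijOn Φ (isoClass '' {M | Angulated.IsMaxRelRigid S T M})
        (isoClass '' {p | TauTilting.IsSupportTauTiltingPair k n (TauTilting.imageD k T) p.1 p.2}) ∧
      Set.BijOn Φ (isoClass '' {M | Angulated.IsRelSelfPerp S T M})
        (isoClass '' {p | TauTilting.IsMaxTauRigidPair k n (TauTilting.imageD k T) p.1 p.2}) := by
  obtain ⟨m, rfl⟩ := Nat.exists_eq_succ_of_ne_zero hn.ne'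
  refine ⟨fun M hM => ?_, fun M => Angulated.exists_isDecomposition k T M, ?_⟩
  · exact (TauTilting.homTauZero_iff_factorZero k hT hM (.refl _ _) (.refl _ _)).symm
  -- `Φ` is defined by chosen representatives and decompositions; `nonempty_equiv` shows that the
  -- choices do not matter.
  choose M₀ TM h using fun q : Quotient (isIsomorphicSetoid C) =>
    Angulated.exists_isDecomposition k (S := S) T q.out
  let Φ : Quotient (isIsomorphicSetoid C) → Quotient (isIsomorphicSetoid
      (FGModuleCat.{v} (End T)ᵐᵒᵖ × FGModuleCat.{v} (End T)ᵐᵒᵖ)) := fun q =>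
    isoClass ((TauTilting.homFunctor k T).obj (M₀ q), (TauTilting.homFunctor k T).obj (TM q))
  have hΦ : ∀ {X M P M₀ TM}, TauTilting.Corresponds S T k X M P M₀ TM →
      Φ (isoClass X) = isoClass (M, P) := by
    intro X M P M₀ TM c
    obtain ⟨c'⟩ := TauTilting.nonempty_corresponds_of_isDecomposition k (h (isoClass X))
    obtain ⟨e⟩ : Nonempty ((isoClass X).out ≅ X) := Quotient.exact (Quotient.out_eq (isoClass X))
    exact TauTilting.isoClass_prod_eq_iff.2 (c'.nonempty_equiv hT c e)
  refine ⟨Φ, fun M M₀ TM hM => ?_, ?_, ?_, ?_⟩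
  · obtain ⟨c⟩ := TauTilting.nonempty_corresponds_of_isDecomposition k hM
    exact hΦ c
  · exact TauTilting.bijOn_of_corresponds k hT hΦ (fun c => c.isRelRigid_iff hT)
      fun h => ⟨h.mem, h.projective⟩
  · exact TauTilting.bijOn_of_corresponds k hT hΦ (fun c => c.isMaxRelRigid_iff hT)
      fun h => ⟨h.rigidPair.mem, h.rigidPair.projective⟩
  · exact TauTilting.bijOn_of_corresponds k hT hΦ (fun c => c.isRelSelfPerp_iff hT)
      fun h => ⟨h.mem, h.projective⟩
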